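/- Let $m\ge 1$, $n\ge 0$ and $1\le r\le \binom{n+m}{m}$. Let $\mathrm{S}^m(\mathbb{C}^{n+1})$ be the space of symmetric tensors of order $m$ on $\mathbb{C}^{n+1}$, and let $\sigma_r\subseteq\mathbb{P}\,\mathrm{S}^m(\mathbb{C}^{n+1})$ be the Zariski closure of the set of classes of the nonzero tensors $u_1^{\otimes m}+\cdots+u_r^{\otimes m}$ with $u_1,\dots,u_r\in\mathbb{C}^{n+1}$. For $\mathcal{F}\in\sigma_r$ let $$\mathrm{afiber}_r(\mathcal{F})=\Big\{\mathrm{perm}(v_1,\dots,v_r)\;:\; v_i\in\mathbb{C}^n,\ \mathcal{F}=\lambda_1(1,v_1)^{\otimes m}+\cdots+\lambda_r(1,v_r)^{\otimes m}\ \text{for some } \lambda_1,\dots,\lambda_r\in\mathbb{C}\Big\},$$ where the equality is meant in $\mathbb{P}\,\mathrm{S}^m(\mathbb{C}^{n+1})$ and $\mathrm{perm}(v_1,\dots,v_r)$ is the set of all permutations of the tuple $(v_1,\dots,v_r)$; its dimension is that of the set of all these tuples in $(\mathbb{C}^n)^r$. Let $\mathbb{B}_0$ be the set of the first $r$ monomials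 in the graded lexicographic list $1,x_1,\dots,x_n,x_1^2,x_1x_2,\dots$, let $[v]_{\mathbb{B}_0}$ be the vector of values of these monomials at $v\in\mathbb{C}^n$, and let $$D=\big\{(v_1,\dots,v_r)\in(\mathbb{C}^n)^r:\ \det\big([v_1]_{\mathbb{B}_0}\ \cdots\ [v_r]_{\mathbb{B}_0}\big)\neq 0\big\}.$$ Then $d:=r(n+1)-1-\dim\sigma_r$ is a nonnegative integer, and for general $\mathcal{F}\in\sigma_r$ (that is, for all $\mathcal{F}$ in a Zariski open dense subset of $\sigma_r$) we have $\dim\big(\mathrm{afiber}_r(\mathcal{F})\big)=d$ and the following properties: (i) If $d=0$, then $(v_1,\dots,v_r)\in D$ for all $\mathrm{perm}(v_1,\dots,v_r)\in\mathrm{afiber}_r(\mathcal{F})$. (ii) If $d>0$, then for a general linear subspace $S\subseteq(\mathbb{C}^n)^r$ of codimension $d$, and likewise for a general affine subspace $S\subseteq(\mathbb{C}^n)^r$ of codimension $d$ (where "general" may depend on $\mathcal{F}$), we have $(v_1,\dots,v_r)\in D$ for all $(v_1,\dots,v_r)\in S$ with $\mathrm{perm}(v_1,\dots,v_r)\in\mathrm{afiber}_r(\mathcal{F})$.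 -/

import Mathlib

open scoped LinearAlgebra.Projectivization

namespace SymDecomp

/-! ### Zariski closed sets, dimension, general points -/

/-- The dimension of a subset of the affine space `ℂ^ι` (that is, of its Zariski closure):
the Krull dimension of its coordinate ring. It is `⊥` for the empty set. -/
noncomputable def affineDim {ι : Type} (T : Set (ι → ℂ)) : WithBot ℕ∞ :=
  ringKrullDim (MvPolynomial ι ℂ ⧸ MvPolynomial.vanishingIdeal ℂ T)

/-- Zariski closed subsets of the projective space `ℙ(ℂ^ι)`: the common zero sets of
families of homogeneous polynomials. -/
def IsProjClosed {ι : Type} (Z : Set (ℙ ℂ (ι → ℂ))) : Prop :=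
  ∃ I : Set (MvPolynomial ι ℂ), (∀ f ∈ I, ∃ k : ℕ, f.IsHomogeneous k) ∧
    Z = {x | ∀ f ∈ I, MvPolynomial.eval x.rep f = 0}

/-- Zariski closure in projective space. -/
def projClosure {ι : Type} (Z : Set (ℙ ℂ (ι → ℂ))) : Set (ℙ ℂ (ι → ℂ)) :=
  ⋂₀ {W | IsProjClosed W ∧ Z ⊆ W}

/-- The affine cone (with its vertex) over a subset of projective space. -/
def affineCone {ι : Type} (Z : Set (ℙ ℂ (ι → ℂ))) : Set (ι → ℂ) :=
  {w | ∀ h : w ≠ 0, Projectivization.mk ℂ w h ∈ Z}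

/-- The projective set `Z` has dimension `s`: its homogeneous coordinate ring, the coordinate
ring of its affine cone, has Krull dimension `s + 1`. -/
def HasProjDim {ι : Type} (Z : Set (ℙ ℂ (ι → ℂ))) (s : ℕ) : Prop :=
  affineDim (affineCone Z) = (s : WithBot ℕ∞) + 1

/-- `P` holds for a general point of `Z`: it holds on a Zariski open dense subset `Z ∩ U`
of `Z`. -/
def ForGeneralPoint {ι : Type} (Z : Set (ℙ ℂ (ι → ℂ))) (P : ℙ ℂ (ι → ℂ) → Prop) : Prop :=
  ∃ U : Set (ℙ ℂ (ι → ℂ)), IsProjClosed Uᶜ ∧ Z ⊆ projClosure (Z ∩ U) ∧ ∀ x ∈ Z ∩ U, P x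

/-! ### Symmetric tensors and the secant variety -/

/-- Symmetric tensors of order `m` on `ℂ^{n+1}`. An array `F i₁ … iₘ` (`0 ≤ iⱼ ≤ n`) that is
invariant under permutation of its indices is the same thing as a function of the multiset
`{i₁, …, iₘ}`. -/
abbrev SymTensor (n m : ℕ) : Type := Sym (Fin (n + 1)) m → ℂ

/-- The symmetric tensor power `u^{⊗ m}`, whose entry at `i₁ … iₘ` is `u i₁ * ⋯ * u iₘ`. -/
noncomputable def tensorPow {n : ℕ} (m : ℕ) (u : Fin (n + 1) → ℂ) : SymTensor n m :=
  fun s => ((s : Multiset (Fin (n + 1))).map u).prod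

/-- The `r`-th secant variety `σ_r` of the Veronese variety: the Zariski closure in
`ℙ(S^m(ℂ^{n+1}))` of the classes of the nonzero sums `u₁^{⊗ m} + ⋯ + u_r^{⊗ m}`. -/
noncomputable def secantVariety (n m r : ℕ) : Set (ℙ ℂ (SymTensor n m)) :=
  projClosure {x | ∃ (u : Fin r → Fin (n + 1) → ℂ) (h : ∑ i, tensorPow m (u i) ≠ 0),
    x = Projectivization.mk ℂ (∑ i, tensorPow m (u i)) h}

/-! ### The affine fiber of decompositions -/

/-- The set of all permutations of the tuple `(v₁, …, v_r)`. -/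
def perm {n r : ℕ} (v : Fin r → Fin n → ℂ) : Set (Fin r → Fin n → ℂ) :=
  {w | ∃ τ : Equiv.Perm (Fin r), w = v ∘ τ}

/-- The tensor `λ₁ (1, v₁)^{⊗ m} + ⋯ + λ_r (1, v_r)^{⊗ m}`. -/
noncomputable def affineSum {n r : ℕ} (m : ℕ) (lam : Fin r → ℂ) (v : Fin r → Fin n → ℂ) :
    SymTensor n m :=
  ∑ i, lam i • tensorPow m (Fin.cons 1 (v i) : Fin (n + 1) → ℂ)

/-- The affine fiber of length-`r` decompositions: the set of all `perm (v₁, …, v_r)` such that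
`F = λ₁ (1, v₁)^{⊗ m} + ⋯ + λ_r (1, v_r)^{⊗ m}` in `ℙ(S^m(ℂ^{n+1}))` for some
`λ₁, …, λ_r ∈ ℂ`. -/
def afiber {n m : ℕ} (r : ℕ) (F : ℙ ℂ (SymTensor n m)) : Set (Set (Fin r → Fin n → ℂ)) :=
  {c | ∃ v : Fin r → Fin n → ℂ, c = perm v ∧
    ∃ (lam : Fin r → ℂ) (h : affineSum m lam v ≠ 0),
      F = Projectivization.mk ℂ (affineSum m lam v) h}

/-- The dimension of a set of permutation classes of tuples, i.e. the dimension of the set of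
all tuples in these classes as a subset of the affine space `(ℂ^n)^r`. (Each class is finite,
so that passing to classes does not change the dimension.) -/
noncomputable def dimClasses {n r : ℕ} (C : Set (Set (Fin r → Fin n → ℂ))) : WithBot ℕ∞ :=
  affineDim (Function.uncurry '' ⋃₀ C)

/-! ### The monomials `B₀` and the open set `D` -/

/-- `x^α` comes strictly before `x^β` in the list
`1, x₁, …, xₙ, x₁², x₁x₂, …` (graded lexicographic order). -/
def Precedes {n : ℕ} (α β : Fin n → ℕ) : Prop :=
  ∑ k, α k < ∑ k, β k ∨
    (∑ k, α k = ∑ k, β k ∧ ∃ k, (∀ j < k, α j = β j) ∧ β k < α k)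

/-- The exponents of the first `r` monomials in the list `1, x₁, …, xₙ, x₁², x₁x₂, …`: those with
fewer than `r` predecessors (every exponent has only finitely many). -/
def B0 (n r : ℕ) : Set (Fin n → ℕ) :=
  {β | {α | Precedes α β}.ncard < r}

/-- The set `D` of the tuples `(v₁, …, v_r)` for which the square matrix with columns
`[v₁]_{B₀}, …, [v_r]_{B₀}` is nonsingular. The rows are numbered by a bijection `e`, whose choice
only changes the sign of the determinant. -/
def D (n r : ℕ) : Set (Fin r → Fin n → ℂ) :=
  {v | ∃ e : Fin r ≃ B0 n r,
    (Matrix.of fun i j : Fin r => ∏ k, v j k ^ (e i : Fin n → ℕ) k).det ≠ 0}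

/-! ### General subspaces of `(ℂ^n)^r` -/

/-- The solution set in `(ℂ^n)^r` of the `d` linear equations with coefficients `A` and right-hand
sides `b`. -/
def solutionSet {n r d : ℕ} (A : Fin d → Fin r → Fin n → ℂ) (b : Fin d → ℂ) :
    Set (Fin r → Fin n → ℂ) :=
  {v | ∀ i, ∑ j, ∑ k, A i j k * v j k = b i}

/-- `P S` holds for a general linear subspace `S ⊆ (ℂ^n)^r` of codimension `d`: outside the zero
set of some nonzero polynomial in the coefficients, the `d` homogeneous linear equations are
independent and `P` holds for the subspace that they define. -/
def ForGeneralLinearSubspace (n r d : ℕ) (P : Set (Fin r → Fin n → ℂ) → Prop) : Prop :=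
  ∃ p : MvPolynomial (Fin d × Fin r × Fin n) ℂ, p ≠ 0 ∧
    ∀ A : Fin d → Fin r → Fin n → ℂ,
      MvPolynomial.eval (fun x => A x.1 x.2.1 x.2.2) p ≠ 0 →
        LinearIndependent ℂ A ∧ P (solutionSet A 0)

/-- The same for a general affine subspace of codimension `d`, where the right-hand sides of the
equations are general as well. -/
def ForGeneralAffineSubspace (n r d : ℕ) (P : Set (Fin r → Fin n → ℂ) → Prop) : Prop :=
  ∃ p : MvPolynomial ((Fin d × Fin r × Fin n) ⊕ Fin d) ℂ, p ≠ 0 ∧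
    ∀ (A : Fin d → Fin r → Fin n → ℂ) (b : Fin d → ℂ),
      MvPolynomial.eval (Sum.elim (fun x => A x.1 x.2.1 x.2.2) b) p ≠ 0 →
        LinearIndependent ℂ A ∧ P (solutionSet A b)

end SymDecomp

/-!
The tensors `λ₁ (1, v₁)^{⊗ m} + ⋯ + λ_r (1, v_r)^{⊗ m}` are the image of a polynomial map `φ`
(`affineSumPoly`) on the affine space of all `(λ, v)`, of dimension `r (n + 1)`. Every tensor
`u^{⊗ m}` is a limit of multiples of `(1, v)^{⊗ m}`, so the closure of the image is the cone over
`σ_r`: the ideal of the cone is the kernel of the substitution `P ↦ P(φ)` (`vanishingIdeal_affineCone`).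
The coordinate ring `A` of the cone is thus a subring of the polynomial ring `ℂ[λ, v]`, its
dimension `e = dim σ_r + 1` is its transcendence degree, and `d = r (n + 1) - e` is the
transcendence degree of `ℂ[λ, v]` over `A`.

Since the cone is the closure of the image, "for general `F`" may be read as "where a polynomial
`h` with `h(φ) ≠ 0` is nonzero" (`genericFilter`, `forGeneralPoint_of_eventually`). The geometry
of general fibres then comes from counting transcendence degrees.

* Any `d + 1` coordinates `v i k` are algebraically dependent over `A`, and a relation stays
  nontrivial over a general `F`. This bounds the dimension of the fibre by `d`
  (`eventually_exists_relation_of_lt`).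
* By Cramer's rule on the rows of `B₀`, which have degree at most `m` because
  `r ≤ (n + m).choose m`, each `λ i` is algebraic over `A[v]` (`isAlgebraic_param`). Hence a transcendence basis of
  `ℂ[λ, v]` over `A` can be chosen among the `v i k`. Lifting points through the algebraic
  extension (`exists_eval_eq_of_isAlgebraic`) shows that these `d` coordinates take a dense set of
  values on a general fibre (`eventually_dense`), so the dimension is exactly `d`.
* The complement of `D` is the hypersurface `g = 0` of a determinant `g` that is not the zero
  polynomial (`det_monomialMatrix_ne_zero`). If `g ≠ 0` is algebraic over a subring, then `g`
  divides a nonzero element of this subring (`exists_dvd_aeval`), so that on `g = 0` the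
  transcendence degrees drop by one. Applied to the incidence variety of the points of the fibre
  and the systems of `d` linear equations that they satisfy, this shows that the systems with a
  solution on `g = 0` are themselves solutions of a nontrivial polynomial equation
  (`eventually_linear_section`). Affine subspaces are treated in the homogeneous coordinates
  `(-1, v)`, and linear ones in the coordinates `v`, where `v = 0` has to be excluded separately. The
  case `d = 0` is that of the affine subspace defined by no equations.
-/

namespace SymDecomp

/-! ### Krull dimension and transcendence degree -/

theorem exists_fin_isTranscendenceBasis (R : Type*) {A κ : Type*} [CommRing R] [CommRing A]
    [Algebra R A] [NoZeroDivisors A] [FaithfulSMul R A] [Finite κ] (b : κ → A)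
    [Algebra.IsAlgebraic (Algebra.adjoin R (Set.range b)) A] :
    ∃ (n : ℕ) (x : Fin n → κ), IsTranscendenceBasis R (b ∘ x) := by
  obtain ⟨t, ht, hb⟩ := exists_isTranscendenceBasis_subset (R := R) (Set.range b)
  have : Finite t := (Set.finite_range b).subset ht
  choose f hf using fun a : t => ht a.2
  refine ⟨Nat.card t, f ∘ (Finite.equivFin t).symm, ?_⟩
  have : b ∘ f ∘ (Finite.equivFin t).symm = ((↑) : t → A) ∘ (Finite.equivFin t).symm :=
    funext fun i => hf _
  rw [this]
  exact (isTranscendenceBasis_equiv (Finite.equivFin t).symm).mpr hb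

theorem isAlgebraic_adjoin_of_eq_top {R A : Type*} [CommRing R] [CommRing A] [Nontrivial A]
    [Algebra R A] {s : Set A} (h : Algebra.adjoin R s = ⊤) :
    Algebra.IsAlgebraic (Algebra.adjoin R s) A :=
  ⟨fun a => isAlgebraic_algebraMap (⟨a, h ▸ Algebra.mem_top⟩ : Algebra.adjoin R s)⟩

theorem ringKrullDim_eq_of_isIntegral {R S : Type*} [CommRing R] [CommRing S] [Algebra R S]
    [Algebra.IsIntegral R S] (h : Function.Injective (algebraMap R S)) :
    ringKrullDim S = ringKrullDim R := by
  refine le_antisymm ?_ ?_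
  · refine Order.krullDim_le_of_strictMono (PrimeSpectrum.comap (algebraMap R S)) ?_
    intro p q hpq
    exact Ideal.IsIntegral.comap_lt_comap hpq
  · refine iSup_le fun l => ?_
    obtain ⟨P, -, hP, hP''⟩ := Ideal.exists_ideal_over_prime_of_isIntegral
      (S := S) l.head.asIdeal ⊥ (by
        rw [← RingHom.ker_eq_comap_bot, (RingHom.injective_iff_ker_eq_bot _).mp h]; exact bot_le)
    have : P.LiesOver l.head.asIdeal := ⟨hP''.symm⟩
    obtain ⟨L, hL, -⟩ := Ideal.exists_ltSeries_of_hasGoingUp l P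
    rw [← hL]
    exact le_iSup (fun p : LTSeries (PrimeSpectrum S) => (p.length : WithBot ℕ∞)) L

/-- The Krull dimension of a finitely generated domain over a field is its transcendence degree:
both are the number of variables of a Noether normalization. -/
theorem ringKrullDim_eq_of_isTranscendenceBasis {k B : Type*} [Field k] [CommRing B] [IsDomain B]
    [Algebra k B] [Algebra.FiniteType k B] {n : ℕ} {x : Fin n → B}
    (hx : IsTranscendenceBasis k x) : ringKrullDim B = n := by
  obtain ⟨s, g, hg, hint⟩ := exists_integral_inj_algHom_of_fg k B
  let : Algebra (MvPolynomial (Fin s) k) B := g.toRingHom.toAlgebra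
  have : IsScalarTower k (MvPolynomial (Fin s) k) B :=
    IsScalarTower.of_algebraMap_eq fun a => (g.commutes a).symm
  have : Algebra.IsIntegral (MvPolynomial (Fin s) k) B := ⟨hint⟩
  have : FaithfulSMul (MvPolynomial (Fin s) k) B :=
    (faithfulSMul_iff_algebraMap_injective _ _).mpr hg
  have hy := (IsTranscendenceBasis.mvPolynomial (Fin s) k).algebraMap_comp (A := B)
  have hc := hx.lift_cardinalMk_eq hy
  have hns : n = s := by simpa using hc
  rw [ringKrullDim_eq_of_isIntegral (R := MvPolynomial (Fin s) k) hg,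
    MvPolynomial.ringKrullDim_of_isNoetherianRing, ringKrullDim_eq_zero_of_field]
  simp [hns]

/-- Algebraically independent elements stay independent modulo a suitable prime ideal, namely one
that meets their subalgebra in zero. -/
theorem exists_isPrime_algebraicIndependent {k B ι : Type*} [Field k] [CommRing B] [Algebra k B]
    {x : ι → B} (hx : AlgebraicIndependent k x) :
    ∃ p : Ideal B, p.IsPrime ∧ AlgebraicIndependent k (Ideal.Quotient.mkₐ k p ∘ x) := by
  have hinj : Function.Injective (MvPolynomial.aeval x : MvPolynomial ι k →ₐ[k] B).toRingHom := hx
  have hmin : (⊥ : Ideal (MvPolynomial ι k)) ∈ minimalPrimes (MvPolynomial ι k) := by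
    rw [IsDomain.minimalPrimes_eq_singleton_bot]; rfl
  obtain ⟨p, hp, hc⟩ := Ideal.exists_comap_eq_of_mem_minimalPrimes_of_injective hinj _ hmin
  refine ⟨p, hp, ?_⟩
  rw [algebraicIndependent_iff]
  intro f hf
  have h1 : MvPolynomial.aeval (Ideal.Quotient.mkₐ k p ∘ x) f
      = Ideal.Quotient.mkₐ k p (MvPolynomial.aeval x f) := by
    exact (MvPolynomial.comp_aeval_apply _ _ f).symm
  rw [h1] at hf
  have h2 : f ∈ Ideal.comap (MvPolynomial.aeval x : MvPolynomial ι k →ₐ[k] B).toRingHom p :=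
    Ideal.mem_comap.mpr (Ideal.Quotient.eq_zero_iff_mem.mp hf)
  rw [hc] at h2
  exact h2

/-- The algebra need not be a domain: pass to a quotient domain in which the elements stay
independent. -/
theorem le_ringKrullDim_of_algebraicIndependent {k B : Type*} [Field k] [CommRing B]
    [Algebra k B] [Algebra.FiniteType k B] {d : ℕ} {x : Fin d → B}
    (hx : AlgebraicIndependent k x) : (d : WithBot ℕ∞) ≤ ringKrullDim B := by
  obtain ⟨p, hp, hxp⟩ := exists_isPrime_algebraicIndependent hx
  refine le_trans ?_ (ringKrullDim_quotient_le p)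
  obtain ⟨m, f, hf⟩ := Algebra.FiniteType.iff_quotient_mvPolynomial''.mp
    (inferInstance : Algebra.FiniteType k (B ⧸ p))
  have hadj : Algebra.adjoin k (Set.range (f ∘ MvPolynomial.X)) = ⊤ := by
    rw [Set.range_comp, ← AlgHom.map_adjoin, MvPolynomial.adjoin_range_X, Algebra.map_top,
      (AlgHom.range_eq_top f).mpr hf]
  have : Algebra.IsAlgebraic (Algebra.adjoin k (Set.range (f ∘ MvPolynomial.X))) (B ⧸ p) :=
    isAlgebraic_adjoin_of_eq_top hadj
  obtain ⟨n, y, hy⟩ := exists_fin_isTranscendenceBasis k (f ∘ MvPolynomial.X)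
  rw [ringKrullDim_eq_of_isTranscendenceBasis hy]
  have h1 := hxp.lift_cardinalMk_le_trdeg
  rw [← hy.lift_cardinalMk_eq_trdeg] at h1
  have : d ≤ n := by simpa using h1
  exact_mod_cast this

/-- If any `d + 1` of the generators `b` are dependent, the dimension is at most `d`: the variables
of a Noether normalization stay independent modulo some prime, and the transcendence degree of the
quotient is attained among the generators. -/
theorem ringKrullDim_le_of_forall_not_algebraicIndependent {k B κ : Type*} [Field k] [CommRing B]
    [Algebra k B] [Finite κ] {b : κ → B} (hb : Algebra.adjoin k (Set.range b) = ⊤) {d : ℕ}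
    (h : ∀ y : Fin (d + 1) → κ, ¬ AlgebraicIndependent k (b ∘ y)) :
    ringKrullDim B ≤ d := by
  nontriviality B
  have : Algebra.FiniteType k B := ⟨⟨(Set.finite_range b).toFinset, by simpa using hb⟩⟩
  obtain ⟨s, g, hg, hint⟩ := exists_integral_inj_algHom_of_fg k B
  have hdim : ringKrullDim B = s := by
    let : Algebra (MvPolynomial (Fin s) k) B := g.toRingHom.toAlgebra
    have : Algebra.IsIntegral (MvPolynomial (Fin s) k) B := ⟨hint⟩
    rw [ringKrullDim_eq_of_isIntegral (R := MvPolynomial (Fin s) k) hg,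
      MvPolynomial.ringKrullDim_of_isNoetherianRing, ringKrullDim_eq_zero_of_field]
    simp
  rw [hdim]
  by_contra hlt
  have hds : d < s := by
    by_contra h'
    exact hlt (by exact_mod_cast not_lt.mp h')
  have hind : AlgebraicIndependent k (g ∘ MvPolynomial.X) :=
    (MvPolynomial.algebraicIndependent_X (Fin s) k).map' hg
  obtain ⟨p, hp, hxp⟩ := exists_isPrime_algebraicIndependent hind
  have hadj : Algebra.adjoin k (Set.range (Ideal.Quotient.mkₐ k p ∘ b)) = ⊤ := by
    rw [Set.range_comp, ← AlgHom.map_adjoin, hb, Algebra.map_top,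
      (AlgHom.range_eq_top _).mpr (Ideal.Quotient.mkₐ_surjective k p)]
  have : Algebra.IsAlgebraic (Algebra.adjoin k (Set.range (Ideal.Quotient.mkₐ k p ∘ b)))
      (B ⧸ p) :=
    isAlgebraic_adjoin_of_eq_top hadj
  obtain ⟨n, y, hy⟩ := exists_fin_isTranscendenceBasis k (Ideal.Quotient.mkₐ k p ∘ b)
  have h1 := hxp.lift_cardinalMk_le_trdeg
  rw [← hy.lift_cardinalMk_eq_trdeg] at h1
  have hsn : s ≤ n := by simpa using h1
  have h2 := hy.1.comp (Fin.castLE (hds.trans_le hsn)) (Fin.castLE_injective _)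
  exact h (y ∘ Fin.castLE (hds.trans_le hsn)) (AlgebraicIndependent.of_comp _ h2)

/-! ### Points over general points of a subring -/

/-- If `ℂ[σ]` is algebraic over a subring `B`, then almost every `ℂ`-point of `B` is the
restriction of an evaluation: the exceptional points are zeros of a fixed nonzero `K ∈ B`. Here
`K` is chosen such that all elements of `ℂ[σ]` become integral after multiplication by a power of
`K`, and a prime ideal is lifted through the integral closure of `B`. -/
theorem exists_eval_eq_of_isAlgebraic {σ B : Type*} [Finite σ] [CommRing B] [IsDomain B]
    [Algebra ℂ B] [Algebra B (MvPolynomial σ ℂ)] [IsScalarTower ℂ B (MvPolynomial σ ℂ)]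
    [FaithfulSMul B (MvPolynomial σ ℂ)] [Algebra.IsAlgebraic B (MvPolynomial σ ℂ)] :
    ∃ K : B, K ≠ 0 ∧ ∀ ev : B →ₐ[ℂ] ℂ, ev K ≠ 0 → ∃ z : σ → ℂ, ∀ b : B,
      MvPolynomial.eval z (algebraMap B (MvPolynomial σ ℂ) b) = ev b := by
  classical
  have := Fintype.ofFinite σ
  set P := MvPolynomial σ ℂ
  obtain ⟨K, hK0, hK⟩ := Algebra.IsAlgebraic.exists_integral_multiples B
    (Finset.univ.image (MvPolynomial.X : σ → P))
  have hpow : ∀ c : P, ∃ N : ℕ, IsIntegral B (K ^ N • c) := by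
    intro c
    induction c using MvPolynomial.induction_on with
    | C a =>
      refine ⟨0, ?_⟩
      have : (MvPolynomial.C a : P) = algebraMap B P (algebraMap ℂ B a) := by
        rw [← IsScalarTower.algebraMap_apply]; rfl
      rw [pow_zero, one_smul, this]
      exact isIntegral_algebraMap
    | add p q hp hq =>
      obtain ⟨N, hN⟩ := hp
      obtain ⟨M, hM⟩ := hq
      refine ⟨N + M, ?_⟩
      rw [smul_add]
      refine IsIntegral.add ?_ ?_
      · rw [add_comm, pow_add, mul_smul]; exact hN.smul _
      · rw [pow_add, mul_smul]; exact hM.smul _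
    | mul_X p i hp =>
      obtain ⟨N, hN⟩ := hp
      refine ⟨N + 1, ?_⟩
      rw [pow_succ, mul_smul_mul_comm]
      exact hN.mul (hK _ (Finset.mem_image_of_mem _ (Finset.mem_univ i)))
  refine ⟨K, hK0, fun ev hev => ?_⟩
  -- The kernel of `ev` is lifted to `q'` in the integral closure; `K` is invertible modulo it,
  -- so that the extension of the kernel to `ℂ[σ]` contracts to the kernel again.
  set m : Ideal B := RingHom.ker ev with hm
  have hmp : m.IsPrime := RingHom.ker_isPrime _
  obtain ⟨q', -, hq', hq'm⟩ := Ideal.exists_ideal_over_prime_of_isIntegral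
    (S := integralClosure B P) m ⊥ (by
      rw [← RingHom.ker_eq_comap_bot, (RingHom.injective_iff_ker_eq_bot _).mp
        (FaithfulSMul.algebraMap_injective B _)]
      exact bot_le)
  have hKm : ∀ N : ℕ, K ^ N ∉ m := fun N h => hev (hmp.mem_of_pow_mem N h)
  have key : ∀ z ∈ m.map (algebraMap B P), ∃ (N : ℕ) (y : integralClosure B P),
      y ∈ q' ∧ (y : P) = K ^ N • z := by
    intro z hz
    refine Submodule.span_induction ?_ ?_ ?_ ?_ hz
    · rintro _ ⟨x, hx, rfl⟩
      refine ⟨0, algebraMap B _ x, ?_, by simp⟩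
      rw [← hq'm] at hx
      exact hx
    · exact ⟨0, 0, q'.zero_mem, by simp⟩
    · rintro a b - - ⟨N, y, hy, hya⟩ ⟨M, w, hw, hwb⟩
      refine ⟨N + M, K ^ M • y + K ^ N • w, ?_, ?_⟩
      · exact q'.add_mem (Submodule.smul_of_tower_mem q' _ hy)
          (Submodule.smul_of_tower_mem q' _ hw)
      · change K ^ M • (y : P) + K ^ N • (w : P) = _
        rw [hya, hwb, smul_add, smul_smul, smul_smul, pow_add, mul_comm]
    · rintro c a - ⟨N, y, hy, hya⟩
      obtain ⟨M, hM⟩ := hpow c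
      refine ⟨M + N, ⟨K ^ M • c, hM⟩ * y, q'.mul_mem_left _ hy, ?_⟩
      change K ^ M • c * (y : P) = _
      rw [hya, smul_mul_smul_comm, ← pow_add, smul_eq_mul]
  have hcomap : (m.map (algebraMap B P)).comap (algebraMap B P) = m := by
    refine le_antisymm (fun b hb => ?_) Ideal.le_comap_map
    obtain ⟨N, y, hy, hyb⟩ := key _ hb
    have hy' : y = algebraMap B _ (K ^ N * b) := by
      apply Subtype.ext
      rw [hyb, Algebra.smul_def, ← map_mul]
      rfl
    rw [hy'] at hy
    have : K ^ N * b ∈ m := by rw [← hq'm]; exact hy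
    exact (hmp.mem_or_mem this).resolve_left (hKm N)
  obtain ⟨q, hq, hqm⟩ := (Ideal.comap_map_eq_self_iff_of_isPrime m).mp hcomap
  obtain ⟨M, hM, hqM⟩ := Ideal.exists_le_maximal q hq.ne_top
  -- By the Nullstellensatz, a maximal ideal over the kernel is a point.
  obtain ⟨z, rfl⟩ := MvPolynomial.isMaximal_iff_eq_vanishingIdeal_singleton.mp hM
  refine ⟨z, fun b => ?_⟩
  have h1 : b - algebraMap ℂ B (ev b) ∈ m := by
    rw [hm, RingHom.mem_ker, map_sub, AlgHom.commutes]; simp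
  rw [← hqm] at h1
  have h2 := (MvPolynomial.mem_vanishingIdeal_singleton_iff _ _).mp (hqM h1)
  rw [map_sub, ← IsScalarTower.algebraMap_apply, map_sub, AlgHom.commutes] at h2
  have h3 := sub_eq_zero.mp h2
  rw [MvPolynomial.aeval_eq_eval] at h3
  exact h3

/-! ### Relations on general fibres of a polynomial map -/

/-- Given at least as many polynomials `f` as there are variables, and `g ≠ 0`, some nontrivial
polynomial expression in the `f` is a multiple of `g`. Either the `f` are dependent and the
expression is zero, or they are a transcendence basis, `g` is algebraic over them, and the
expression is the constant term of an equation of `g`. -/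
theorem exists_dvd_aeval {σ ι : Type} [Finite σ] [Finite ι] (f : ι → MvPolynomial σ ℂ)
    (hcard : Nat.card σ ≤ Nat.card ι) {g : MvPolynomial σ ℂ} (hg : g ≠ 0) :
    ∃ q : MvPolynomial ι ℂ, q ≠ 0 ∧ g ∣ MvPolynomial.aeval f q := by
  by_cases hf : AlgebraicIndependent ℂ f
  · have htr : Algebra.trdeg ℂ (MvPolynomial σ ℂ) ≤ Cardinal.mk ι := by
      rw [MvPolynomial.trdeg_of_isDomain, Cardinal.lift_id]
      have := Fintype.ofFinite σ
      have := Fintype.ofFinite ι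
      simpa using hcard
    have hb := hf.isTranscendenceBasis_of_trdeg_le_of_finite htr
    have := hb.isAlgebraic
    obtain ⟨⟨y, hy⟩, hy0, hgy⟩ := (Algebra.IsAlgebraic.isAlgebraic (R := Algebra.adjoin ℂ
      (Set.range f)) g).exists_nonzero_dvd (mem_nonZeroDivisors_of_ne_zero hg)
    rw [Algebra.adjoin_range_eq_range_aeval] at hy
    obtain ⟨q, rfl⟩ := hy
    refine ⟨q, ?_, hgy⟩
    rintro rfl
    exact hy0 (Subtype.ext (map_zero _))
  · rw [algebraicIndependent_iff] at hf
    push Not at hf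
    obtain ⟨q, hq, hq0⟩ := hf
    exact ⟨q, hq0, hq ▸ dvd_zero g⟩

/-- The filter of the properties of general points of the closure of the image of the polynomial
map `φ`: those that hold where a polynomial `h` that does not vanish identically on the image is
nonzero. -/
def genericFilter {σ ι : Type} (φ : ι → MvPolynomial σ ℂ) : Filter (ι → ℂ) where
  sets := {Q | ∃ h : MvPolynomial ι ℂ, MvPolynomial.aeval φ h ≠ 0 ∧
    ∀ F ∈ MvPolynomial.zeroLocus ℂ (RingHom.ker (MvPolynomial.aeval (R := ℂ) φ)),
      MvPolynomial.eval F h ≠ 0 → F ∈ Q}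
  univ_sets := ⟨1, by simp, by simp⟩
  sets_of_superset := fun ⟨h, h0, hh⟩ hs => ⟨h, h0, fun F hF hne => hs (hh F hF hne)⟩
  inter_sets := by
    rintro s t ⟨h, h0, hh⟩ ⟨k, k0, hk⟩
    refine ⟨h * k, by simpa using ⟨h0, k0⟩, fun F hF hne => ?_⟩
    rw [map_mul] at hne
    exact ⟨hh F hF (left_ne_zero_of_mul hne), hk F hF (right_ne_zero_of_mul hne)⟩

theorem eventually_genericFilter {σ ι : Type} {φ : ι → MvPolynomial σ ℂ} {Q : (ι → ℂ) → Prop} :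
    (∀ᶠ F in genericFilter φ, Q F) ↔ ∃ h : MvPolynomial ι ℂ, MvPolynomial.aeval φ h ≠ 0 ∧
    ∀ F ∈ MvPolynomial.zeroLocus ℂ (RingHom.ker (MvPolynomial.aeval (R := ℂ) φ)),
      MvPolynomial.eval F h ≠ 0 → Q F := Iff.rfl

/-- On the hypersurface `g = 0` of a general fibre of `φ`, any family `w` of polynomials that is at
least as long as the expected fibre dimension satisfies a nontrivial relation. The family `ε`
selects algebraically independent coordinates of `φ`, and `τ` numbers auxiliary variables. -/
theorem eventually_exists_relation {σ τ ι E κ : Type} [Finite σ] [Finite τ] [Finite E] [Finite κ]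
    {φ : ι → MvPolynomial σ ℂ} {ε : E → ι} (hε : AlgebraicIndependent ℂ (φ ∘ ε))
    (w : κ → MvPolynomial (σ ⊕ τ) ℂ) {g : MvPolynomial (σ ⊕ τ) ℂ} (hg : g ≠ 0)
    (hcard : Nat.card σ + Nat.card τ ≤ Nat.card E + Nat.card κ) :
    ∀ᶠ F in genericFilter φ, ∃ q : MvPolynomial κ ℂ, q ≠ 0 ∧ ∀ (z : σ → ℂ) (t : τ → ℂ),
      (∀ i, MvPolynomial.eval z (φ i) = F i) → MvPolynomial.eval (Sum.elim z t) g = 0 →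
        MvPolynomial.eval (fun k => MvPolynomial.eval (Sum.elim z t) (w k)) q = 0 := by
  obtain ⟨q, hq0, c, hq⟩ := exists_dvd_aeval
    (Sum.elim w (fun i => MvPolynomial.rename Sum.inl (φ (ε i)))) (by
      rw [Nat.card_sum, Nat.card_sum]; omega) hg
  set q' : MvPolynomial κ (MvPolynomial E ℂ) := MvPolynomial.sumAlgEquiv ℂ κ E q with hq'
  have hq'0 : q' ≠ 0 := by simpa [hq'] using hq0
  obtain ⟨μ, hμ⟩ := MvPolynomial.ne_zero_iff.mp hq'0
  -- The relation stays nontrivial where one of its coefficients, a polynomial in the independent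
  -- coordinates, is nonzero.
  rw [eventually_genericFilter]
  refine ⟨MvPolynomial.rename ε (q'.coeff μ), ?_, fun F _ hF => ?_⟩
  · rw [MvPolynomial.aeval_rename]
    exact fun h => hμ ((algebraicIndependent_iff.mp hε) _ h)
  · refine ⟨MvPolynomial.map (MvPolynomial.eval (F ∘ ε)) q', ?_, fun z t hz hgz => ?_⟩
    · rw [MvPolynomial.ne_zero_iff]
      refine ⟨μ, ?_⟩
      rwa [MvPolynomial.coeff_map, ← MvPolynomial.eval_rename]
    · have h1 : ∀ q : MvPolynomial (κ ⊕ E) ℂ,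
          MvPolynomial.eval (fun k => MvPolynomial.eval (Sum.elim z t) (w k))
            (MvPolynomial.map (MvPolynomial.eval (F ∘ ε)) (MvPolynomial.sumAlgEquiv ℂ κ E q)) =
          MvPolynomial.eval (Sum.elim z t) (MvPolynomial.aeval
            (Sum.elim w (fun i => MvPolynomial.rename Sum.inl (φ (ε i)))) q) := by
        intro q
        induction q using MvPolynomial.induction_on with
        | C a => simp
        | add p q hp hq => simp only [map_add, hp, hq]
        | mul_X p i hp =>
          simp only [map_mul, hp]
          congr 1
          cases i with
          | inl i => simp
          | inr i =>
            simp [MvPolynomial.eval_rename, Function.comp_def, hz]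
      rw [h1, hq, map_mul, hgz, zero_mul]

/-- The fibre over a general `F` satisfies a relation among any family of polynomials that is
longer than the expected fibre dimension. -/
theorem eventually_exists_relation_of_lt {σ ι E κ : Type} [Finite σ] [Finite E] [Finite κ]
    {φ : ι → MvPolynomial σ ℂ} {ε : E → ι} (hε : AlgebraicIndependent ℂ (φ ∘ ε))
    (w : κ → MvPolynomial σ ℂ) (hcard : Nat.card σ < Nat.card E + Nat.card κ) :
    ∀ᶠ F in genericFilter φ, ∃ q : MvPolynomial κ ℂ, q ≠ 0 ∧ ∀ z : σ → ℂ,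
      (∀ i, MvPolynomial.eval z (φ i) = F i) →
        MvPolynomial.eval (fun k => MvPolynomial.eval z (w k)) q = 0 := by
  -- An auxiliary variable `t` plays the role of `g`; the fibre lies in `{t = 0}`.
  have h := eventually_exists_relation hε (τ := Unit)
    (fun k => MvPolynomial.rename Sum.inl (w k)) (MvPolynomial.X_ne_zero (Sum.inr ()))
    (by have : Nat.card Unit = 1 := Nat.card_unique
        omega)
  filter_upwards [h] with F ⟨q, hq0, hq⟩
  refine ⟨q, hq0, fun z hz => ?_⟩
  simpa [MvPolynomial.eval_rename] using hq z 0 hz (by simp)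

/-- A general linear system of `d` equations in the homogeneous coordinates `w` has no solution on
the hypersurface `g = 0` of a general fibre, outside `w k₀ = 0`, if `d` is at least the expected
fibre dimension. The systems that do have a solution are parametrized by the point of the
fibre and the coefficients `B i j`, `j ≠ k₀`, via `A i j = w k₀ * B i j` and
`A i k₀ = - ∑ j, B i j * w j`. -/
theorem eventually_linear_section {σ ι E κ : Type} [Finite σ] [Finite E] [Fintype κ]
    {φ : ι → MvPolynomial σ ℂ} {ε : E → ι} (hε : AlgebraicIndependent ℂ (φ ∘ ε))
    (w : κ → MvPolynomial σ ℂ) (k₀ : κ) {g : MvPolynomial σ ℂ} (hg : g ≠ 0) (d : ℕ)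
    (hcard : Nat.card σ ≤ Nat.card E + d) :
    ∀ᶠ F in genericFilter φ, ∃ p : MvPolynomial (Fin d × κ) ℂ, p ≠ 0 ∧ ∀ z : σ → ℂ,
      (∀ i, MvPolynomial.eval z (φ i) = F i) → MvPolynomial.eval z g = 0 →
      MvPolynomial.eval z (w k₀) ≠ 0 → ∀ A : Fin d × κ → ℂ,
      (∀ i, ∑ k, A (i, k) * MvPolynomial.eval z (w k) = 0) → MvPolynomial.eval A p = 0 := by
  classical
  let f : Fin d × κ → MvPolynomial (σ ⊕ Fin d × {k : κ // k ≠ k₀}) ℂ := fun ik =>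
    if h : ik.2 = k₀ then - ∑ j : {k : κ // k ≠ k₀},
        MvPolynomial.X (Sum.inr (ik.1, j)) * MvPolynomial.rename Sum.inl (w j)
      else MvPolynomial.rename Sum.inl (w k₀) * MvPolynomial.X (Sum.inr (ik.1, ⟨ik.2, h⟩))
  have h := eventually_exists_relation hε f (g := MvPolynomial.rename Sum.inl g)
    (by rwa [Ne, MvPolynomial.rename_eq_zero_iff_of_injective _ Sum.inl_injective]) (by
      have h1 : Fintype.card {k : κ // k ≠ k₀} + 1 = Fintype.card κ := by
        rw [Fintype.card_subtype_compl, Fintype.card_subtype_eq]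
        exact Nat.sub_add_cancel (Fintype.card_pos_iff.mpr ⟨k₀⟩)
      simp only [Nat.card_prod, Nat.card_eq_fintype_card (α := Fin d), Fintype.card_fin,
        Nat.card_eq_fintype_card (α := κ), Nat.card_eq_fintype_card (α := {k : κ // k ≠ k₀}),
        ← h1]
      linarith)
  filter_upwards [h] with F ⟨q, hq0, hq⟩
  refine ⟨q, hq0, fun z hz hgz hw A hA => ?_⟩
  have := hq z (fun ij => A (ij.1, ij.2) / MvPolynomial.eval z (w k₀)) hz
    (by simpa [MvPolynomial.eval_rename] using hgz)
  convert! this using 2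
  refine congrArg MvPolynomial.eval (funext fun ⟨i, k⟩ => ?_)
  by_cases hk : k = k₀
  · subst hk
    have h2 := hA i
    rw [Fintype.sum_eq_add_sum_subtype_ne _ k] at h2
    simp only [f, dif_pos, map_neg, map_sum, map_mul, MvPolynomial.eval_X,
      MvPolynomial.eval_rename, Sum.elim_comp_inl, Sum.elim_inr, div_mul_eq_mul_div]
    rw [← Finset.sum_div, ← neg_div, eq_div_iff hw]
    linear_combination h2
  · simp only [f, dif_neg hk, map_mul, MvPolynomial.eval_X, MvPolynomial.eval_rename,
      Sum.elim_comp_inl, Sum.elim_inr]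
    field_simp

/-- Every point `evA` of `A` together with general values `x₀` of a transcendence basis `x` over `A`
comes from a point of affine space. -/
theorem exists_eval_eq_of_isTranscendenceBasis {σ A : Type} [Finite σ] [CommRing A] [IsDomain A]
    [Algebra ℂ A] [Algebra A (MvPolynomial σ ℂ)] [IsScalarTower ℂ A (MvPolynomial σ ℂ)] {d : ℕ}
    {x : Fin d → σ} (hx : IsTranscendenceBasis A
      (fun j => (MvPolynomial.X (x j) : MvPolynomial σ ℂ))) :
    ∃ K : MvPolynomial (Fin d) A, K ≠ 0 ∧ ∀ (evA : A →ₐ[ℂ] ℂ) (x₀ : Fin d → ℂ),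
      MvPolynomial.aevalTower evA x₀ K ≠ 0 → ∃ z : σ → ℂ,
        (∀ a, MvPolynomial.eval z (algebraMap A (MvPolynomial σ ℂ) a) = evA a) ∧ z ∘ x = x₀ := by
  set b : Fin d → MvPolynomial σ ℂ := fun j => MvPolynomial.X (x j)
  let : Algebra (MvPolynomial (Fin d) A) (MvPolynomial σ ℂ) :=
    (MvPolynomial.aeval b : MvPolynomial (Fin d) A →ₐ[A] _).toRingHom.toAlgebra
  have halg : ∀ q : MvPolynomial (Fin d) A,
      algebraMap (MvPolynomial (Fin d) A) (MvPolynomial σ ℂ) q = MvPolynomial.aeval b q :=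
    fun _ => rfl
  have : IsScalarTower ℂ (MvPolynomial (Fin d) A) (MvPolynomial σ ℂ) := by
    refine IsScalarTower.of_algebraMap_eq fun a => ?_
    rw [halg, MvPolynomial.algebraMap_eq, IsScalarTower.algebraMap_apply ℂ A (MvPolynomial _ A),
      AlgHom.commutes, ← IsScalarTower.algebraMap_apply]
    rfl
  have : FaithfulSMul (MvPolynomial (Fin d) A) (MvPolynomial σ ℂ) :=
    (faithfulSMul_iff_algebraMap_injective _ _).mpr hx.1
  have : Algebra.IsAlgebraic (MvPolynomial (Fin d) A) (MvPolynomial σ ℂ) := by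
    constructor
    intro a
    have := hx.isAlgebraic
    obtain ⟨p, hp0, hp⟩ := Algebra.IsAlgebraic.isAlgebraic (R := Algebra.adjoin A (Set.range b)) a
    refine ⟨p.map hx.1.aevalEquiv.symm.toRingEquiv.toRingHom,
      (Polynomial.map_ne_zero_iff hx.1.aevalEquiv.symm.injective).mpr hp0, ?_⟩
    rw [Polynomial.aeval_def, Polynomial.eval₂_map, ← hp, Polynomial.aeval_def]
    congr 1
    ext1 c
    have h1 := hx.1.aevalEquiv.apply_symm_apply c
    exact congrArg Subtype.val h1
  obtain ⟨K, hK0, hK⟩ := exists_eval_eq_of_isAlgebraic (σ := σ) (B := MvPolynomial (Fin d) A)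
  refine ⟨K, hK0, fun evA x₀ hne => ?_⟩
  obtain ⟨z, hz⟩ := hK (MvPolynomial.aevalTower evA x₀) hne
  refine ⟨z, fun a => ?_, funext fun j => ?_⟩
  · have := hz (MvPolynomial.C a)
    rwa [halg, MvPolynomial.aeval_C, MvPolynomial.aevalTower_C] at this
  · have := hz (MvPolynomial.X j)
    rwa [halg, MvPolynomial.aeval_X, MvPolynomial.aevalTower_X, MvPolynomial.eval_X] at this

/-- A point of the closure of the image of `φ` is an algebra homomorphism on the coordinate ring of
this closure, which is the range of the substitution of `φ`. -/
theorem exists_algHom_range {σ ι : Type} {φ : ι → MvPolynomial σ ℂ} {F : ι → ℂ}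
    (hF : F ∈ MvPolynomial.zeroLocus ℂ (RingHom.ker (MvPolynomial.aeval (R := ℂ) φ))) :
    ∃ ev : (MvPolynomial.aeval (R := ℂ) φ).range →ₐ[ℂ] ℂ, ∀ f : MvPolynomial ι ℂ,
      ev ⟨MvPolynomial.aeval φ f, f, rfl⟩ = MvPolynomial.eval F f := by
  refine ⟨(Ideal.Quotient.liftₐ (RingHom.ker (MvPolynomial.aeval (R := ℂ) φ))
    (MvPolynomial.aeval F) (fun f hf => hF f hf)).comp
      (Ideal.quotientKerEquivRange (MvPolynomial.aeval (R := ℂ) φ)).symm.toAlgHom, fun f => ?_⟩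
  have h1 : (Ideal.quotientKerEquivRange (MvPolynomial.aeval (R := ℂ) φ)).symm
      ⟨MvPolynomial.aeval φ f, f, rfl⟩ = Ideal.Quotient.mk _ f := by
    rw [AlgEquiv.symm_apply_eq]
    rfl
  rw [AlgHom.comp_apply]
  refine (congrArg _ h1).trans ?_
  exact DFunLike.congr_fun (MvPolynomial.coe_aeval_eq_eval F) f

/-- The values of a transcendence basis `x` of the parameters over the ring of the coordinates of
the image fill a dense subset of affine space when the parameters run through a general fibre. -/
theorem eventually_dense {σ ι : Type} [Finite σ] {φ : ι → MvPolynomial σ ℂ} {d : ℕ}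
    {x : Fin d → σ} (hx : IsTranscendenceBasis (MvPolynomial.aeval (R := ℂ) φ).range
      (fun j => (MvPolynomial.X (x j) : MvPolynomial σ ℂ))) :
    ∀ᶠ F in genericFilter φ, ∀ u : MvPolynomial (Fin d) ℂ,
      (∀ z : σ → ℂ, (∀ i, MvPolynomial.eval z (φ i) = F i) →
        MvPolynomial.eval (z ∘ x) u = 0) → u = 0 := by
  obtain ⟨K, hK0, hK⟩ := exists_eval_eq_of_isTranscendenceBasis hx
  obtain ⟨μ, hμ⟩ := MvPolynomial.ne_zero_iff.mp hK0
  obtain ⟨h, hh⟩ := (K.coeff μ).2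
  rw [eventually_genericFilter]
  refine ⟨h, fun h0 => hμ (Subtype.ext (hh.symm.trans h0)), fun F hF hne u hu => ?_⟩
  obtain ⟨ev, hev⟩ := exists_algHom_range hF
  have hk0 : MvPolynomial.map ev.toRingHom K ≠ 0 := by
    rw [MvPolynomial.ne_zero_iff]
    refine ⟨μ, ?_⟩
    rw [MvPolynomial.coeff_map]
    have : K.coeff μ = ⟨MvPolynomial.aeval φ h, h, rfl⟩ := Subtype.ext hh.symm
    rw [this]
    exact (hev h).trans_ne hne
  have hprod : u * MvPolynomial.map ev.toRingHom K = 0 := by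
    refine MvPolynomial.funext fun x₀ => ?_
    rw [map_mul, map_zero]
    by_cases hkx : MvPolynomial.eval x₀ (MvPolynomial.map ev.toRingHom K) = 0
    · rw [hkx, mul_zero]
    · obtain ⟨z, hzF, rfl⟩ := hK ev x₀ (by rwa [MvPolynomial.eval_map] at hkx)
      have hz : ∀ i, MvPolynomial.eval z (φ i) = F i := by
        intro i
        have h1 := (hzF ⟨MvPolynomial.aeval φ (MvPolynomial.X i), _, rfl⟩).trans (hev _)
        rw [MvPolynomial.eval_X] at h1
        rw [← h1]
        exact congrArg _ (MvPolynomial.aeval_X φ i).symm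
      rw [hu z hz, zero_mul]
  exact (mul_eq_zero.mp hprod).resolve_right hk0

/-- Transcendence bases of the coordinate ring of the closure of the image of `φ`, among its
coordinates (`e` of them), and of the parameter ring over it, among given parameters `v` (`d` of
them). The number `e` is the dimension of the closure of the image. -/
theorem exists_transcendence_data {σ ι κ : Type} [Finite σ] [Finite ι] [Finite κ]
    (φ : ι → MvPolynomial σ ℂ) (v : κ → σ)
    (hv : ∀ i, IsAlgebraic (Algebra.adjoin (MvPolynomial.aeval (R := ℂ) φ).range
      (Set.range fun k => (MvPolynomial.X (v k) : MvPolynomial σ ℂ)))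
      (MvPolynomial.X i : MvPolynomial σ ℂ)) :
    ∃ (e d : ℕ) (ε : Fin e → ι) (x : Fin d → κ), AlgebraicIndependent ℂ (φ ∘ ε) ∧
      IsTranscendenceBasis (MvPolynomial.aeval (R := ℂ) φ).range
        (fun j => (MvPolynomial.X (v (x j)) : MvPolynomial σ ℂ)) ∧
      e + d = Nat.card σ ∧
      ringKrullDim (MvPolynomial ι ℂ ⧸ RingHom.ker (MvPolynomial.aeval (R := ℂ) φ)) = e := by
  set A := (MvPolynomial.aeval (R := ℂ) φ).range
  let φ' : ι → A := fun i => ⟨φ i, MvPolynomial.X i, MvPolynomial.aeval_X _ _⟩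
  have hadj : Algebra.adjoin ℂ (Set.range φ') = ⊤ := by
    have : Function.Injective (Subalgebra.map A.val) :=
      Subalgebra.map_injective Subtype.val_injective
    apply this
    rw [AlgHom.map_adjoin, ← Set.range_comp, Algebra.map_top, Subalgebra.range_val]
    exact Algebra.adjoin_range_eq_range_aeval ℂ φ
  have := isAlgebraic_adjoin_of_eq_top hadj
  have hft : Algebra.FiniteType ℂ A := ⟨⟨(Set.finite_range φ').toFinset, by simpa using hadj⟩⟩
  obtain ⟨e, ε, hε⟩ := exists_fin_isTranscendenceBasis ℂ φ'
  set b : κ → MvPolynomial σ ℂ := fun k => MvPolynomial.X (v k)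
  have : Algebra.IsAlgebraic (Algebra.adjoin A (Set.range b)) (MvPolynomial σ ℂ) :=
    (IsTranscendenceBasis.mvPolynomial σ ℂ).isAlgebraic_iff.mpr hv
  obtain ⟨d, x, hx⟩ := exists_fin_isTranscendenceBasis A b
  refine ⟨e, d, ε, x, ?_, hx, ?_, ?_⟩
  · exact hε.1.map' (f := A.val) Subtype.val_injective
  · have h1 := (hε.sumElim_comp hx).lift_cardinalMk_eq (IsTranscendenceBasis.mvPolynomial σ ℂ)
    have := Fintype.ofFinite σ
    have h2 : d + e = Fintype.card σ := by
      have h3 : ((d + e : ℕ) : Cardinal.{0}) = (Fintype.card σ : ℕ) := by simpa using h1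
      exact_mod_cast h3
    rw [Nat.card_eq_fintype_card, ← h2, add_comm]
  · rw [ringKrullDim_eq_of_ringEquiv (Ideal.quotientKerEquivRange
      (MvPolynomial.aeval (R := ℂ) φ)).toRingEquiv]
    exact ringKrullDim_eq_of_isTranscendenceBasis hε

/-! ### The first monomials in graded lexicographic order -/

section Monomials

variable {n : ℕ}

theorem Precedes.sum_le {α β : Fin n → ℕ} (h : Precedes α β) : ∑ k, α k ≤ ∑ k, β k :=
  h.elim le_of_lt fun h => h.1.le

theorem Precedes.irrefl (α : Fin n → ℕ) : ¬ Precedes α α := by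
  rintro (h | ⟨-, k, -, h⟩) <;> exact lt_irrefl _ h

theorem Precedes.trans {α β γ : Fin n → ℕ} (h₁ : Precedes α β) (h₂ : Precedes β γ) :
    Precedes α γ := by
  rcases h₁ with h₁ | ⟨h₁, k, hk, hk'⟩
  · exact Or.inl (h₁.trans_le h₂.sum_le)
  rcases h₂ with h₂ | ⟨h₂, l, hl, hl'⟩
  · exact Or.inl (h₁.trans_lt h₂)
  refine Or.inr ⟨h₁.trans h₂, min k l, fun j hj => ?_, ?_⟩
  · rw [hk j (lt_min_iff.mp hj).1, hl j (lt_min_iff.mp hj).2]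
  · rcases lt_trichotomy k l with h | rfl | h
    · rw [min_eq_left h.le, ← hl k h]; exact hk'
    · rw [min_self]; exact hl'.trans hk'
    · rw [min_eq_right h.le, hk l h]; exact hl'

theorem precedes_or_precedes {α β : Fin n → ℕ} (h : α ≠ β) : Precedes α β ∨ Precedes β α := by
  rcases lt_trichotomy (∑ k, α k) (∑ k, β k) with hs | hs | hs
  · exact Or.inl (Or.inl hs)
  · obtain ⟨k, hk, hmin⟩ := WellFounded.has_min (wellFounded_lt (α := Fin n)) {k | α k ≠ β k}
      (Function.ne_iff.mp h)
    have heq : ∀ j < k, α j = β j := fun j hj => not_not.mp fun hne => hmin j hne hj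
    rcases lt_or_gt_of_ne hk with hlt | hlt
    · exact Or.inr (Or.inr ⟨hs.symm, k, fun j hj => (heq j hj).symm, hlt⟩)
    · exact Or.inl (Or.inr ⟨hs, k, heq, hlt⟩)
  · exact Or.inr (Or.inl hs)

theorem finite_setOf_sum_le (n m : ℕ) : {α : Fin n → ℕ | ∑ k, α k ≤ m}.Finite := by
  refine (Set.finite_Iic (fun _ : Fin n => m)).subset fun α hα k => ?_
  exact (Finset.single_le_sum (fun _ _ => Nat.zero_le _) (Finset.mem_univ k)).trans hα

theorem finite_setOf_precedes (β : Fin n → ℕ) : {α | Precedes α β}.Finite :=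
  (finite_setOf_sum_le n (∑ k, β k)).subset fun _ h => h.sum_le

theorem ncard_precedes_lt {α β : Fin n → ℕ} (h : Precedes α β) :
    {γ | Precedes γ α}.ncard < {γ | Precedes γ β}.ncard := by
  refine Set.ncard_lt_ncard ⟨fun γ hγ => Precedes.trans hγ h, fun hs => ?_⟩
    (finite_setOf_precedes β)
  exact Precedes.irrefl α (hs h)

theorem ncard_precedes_injective :
    Function.Injective fun β : Fin n → ℕ => {α | Precedes α β}.ncard := by
  intro α β h
  by_contra hne
  rcases precedes_or_precedes hne with h' | h'
  · exact (ncard_precedes_lt h').ne h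
  · exact (ncard_precedes_lt h').ne' h

/-- There are at least as many monomials of degree at most `m` in `n` variables as multisets
of size `m` in `n + 1` letters: forget the multiplicity of the letter `0`. -/
theorem choose_le_ncard (n m : ℕ) :
    (n + m).choose m ≤ {α : Fin n → ℕ | ∑ k, α k ≤ m}.ncard := by
  have hcard : (n + m).choose m = Nat.card (Sym (Fin (n + 1)) m) := by
    rw [Nat.card_eq_fintype_card, Sym.card_sym_eq_choose, Fintype.card_fin]
    congr 1
    omega
  have hsum : ∀ s : Sym (Fin (n + 1)) m, (s : Multiset (Fin (n + 1))).count 0 +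
      ∑ k : Fin n, (s : Multiset (Fin (n + 1))).count k.succ = m := by
    intro s
    rw [← Fin.sum_univ_succ (fun k => (s : Multiset (Fin (n + 1))).count k),
      Multiset.sum_count_eq_card (fun _ _ => Finset.mem_univ _)]
    exact s.2
  let f : Sym (Fin (n + 1)) m → {α : Fin n → ℕ | ∑ k, α k ≤ m} := fun s =>
    ⟨fun k => (s : Multiset (Fin (n + 1))).count k.succ, by
      have := hsum s
      simp only [Set.mem_ofPred_eq]
      omega⟩
  have hf : Function.Injective f := by
    intro s t hst
    have h1 : ∀ k : Fin n, (s : Multiset (Fin (n + 1))).count k.succ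
        = (t : Multiset (Fin (n + 1))).count k.succ :=
      fun k => congrFun (congrArg Subtype.val hst) k
    apply Sym.coe_injective
    ext k
    refine Fin.cases ?_ h1 k
    have hs := hsum s
    have ht := hsum t
    rw [Finset.sum_congr rfl fun k _ => h1 k] at hs
    omega
  have : Finite {α : Fin n → ℕ | ∑ k, α k ≤ m} := finite_setOf_sum_le n m
  rw [hcard, ← Nat.card_coe_set_eq]
  exact Nat.card_le_card_of_injective f hf

theorem sum_le_of_mem_B0 {m r : ℕ} (hr : r ≤ (n + m).choose m) {β : Fin n → ℕ}
    (hβ : β ∈ B0 n r) : ∑ k, β k ≤ m := by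
  by_contra hlt
  have h1 : {α : Fin n → ℕ | ∑ k, α k ≤ m} ⊆ {α | Precedes α β} := fun α hα =>
    Or.inl (lt_of_le_of_lt hα (not_le.mp hlt))
  have h2 := Set.ncard_le_ncard h1 (finite_setOf_precedes β)
  have h3 := choose_le_ncard n m
  have h4 : {α | Precedes α β}.ncard < r := hβ
  omega

/-- The number of predecessors is a bijection from `B₀` to the numbers less than `r`. -/
theorem nonempty_equiv_B0 {m r : ℕ} (hr : r ≤ (n + m).choose m) : Nonempty (Fin r ≃ B0 n r) := by
  let f : B0 n r → Fin r := fun β => ⟨{α | Precedes α (β : Fin n → ℕ)}.ncard, β.2⟩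
  refine ⟨(Equiv.ofBijective f ⟨fun α β h => ?_, fun i => ?_⟩).symm⟩
  · exact Subtype.ext (ncard_precedes_injective (congrArg Fin.val h))
  · set S := (finite_setOf_sum_le n m).toFinset with hS
    have hScard : S.card = {α : Fin n → ℕ | ∑ k, α k ≤ m}.ncard :=
      (Set.ncard_eq_toFinset_card _ _).symm
    have hmaps : Set.MapsTo (fun β : Fin n → ℕ => {α | Precedes α β}.ncard) S
        (Finset.range S.card) := by
      intro β hβ
      have hβ' : ∑ k, β k ≤ m := by simpa [hS] using hβ
      simp only [Finset.coe_range, Set.mem_Iio, hScard]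
      refine Set.ncard_lt_ncard ⟨fun γ hγ => ?_, fun hs => ?_⟩ (finite_setOf_sum_le n m)
      · exact (Precedes.sum_le hγ).trans hβ'
      · exact Precedes.irrefl β (hs hβ')
    have hsurj := Finset.surjOn_of_injOn_of_card_le _ hmaps
      (ncard_precedes_injective.injOn) (by simp)
    have hi : (i : ℕ) ∈ (Finset.range S.card : Set ℕ) := by
      have := choose_le_ncard n m
      simp only [Finset.coe_range, Set.mem_Iio, hScard]
      omega
    obtain ⟨β, -, hβ⟩ := hsurj hi
    have hβ' : {α | Precedes α β}.ncard = i := hβ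
    exact ⟨⟨β, show _ < r by rw [hβ']; exact i.2⟩, Fin.ext hβ'⟩

/-- An index of a symmetric tensor whose entry of `(1, v)^{⊗ m}` is the monomial `v^α`: the letter
`k + 1` occurs `α k` times and the letter `0` fills up. -/
def symOfExponent {m : ℕ} (α : Fin n → ℕ) (h : ∑ k, α k ≤ m) : Sym (Fin (n + 1)) m :=
  ⟨Multiset.replicate (m - ∑ k, α k) 0 + ∑ k, Multiset.replicate (α k) k.succ, by
    rw [Multiset.card_add, Multiset.card_sum]
    simp only [Multiset.card_replicate]
    omega⟩

theorem prod_map_symOfExponent {R : Type*} [CommSemiring R] {m : ℕ} (α : Fin n → ℕ)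
    (h : ∑ k, α k ≤ m) (v : Fin n → R) :
    ((symOfExponent α h : Multiset (Fin (n + 1))).map (Fin.cons 1 v : Fin (n + 1) → R)).prod
      = ∏ k, v k ^ α k := by
  change (Multiset.map _ (Multiset.replicate (m - ∑ k, α k) 0 +
    ∑ k, Multiset.replicate (α k) k.succ)).prod = _
  rw [Multiset.map_add, Multiset.prod_add, ← Multiset.coe_mapAddMonoidHom, map_sum,
    Multiset.prod_sum]
  simp

end Monomials

/-! ### The parametrization by points and coefficients -/

section Parametrization

variable (n m r : ℕ)

/-- The parameters of the tensors `λ₁ (1, v₁)^{⊗ m} + ⋯ + λ_r (1, v_r)^{⊗ m}`: the coefficients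
`λ i` and the coordinates `v i k`. -/
abbrev Param : Type := Fin r ⊕ Fin r × Fin n

/-- The entries of `λ₁ (1, v₁)^{⊗ m} + ⋯ + λ_r (1, v_r)^{⊗ m}` as polynomials in the
parameters. -/
noncomputable def affineSumPoly (s : Sym (Fin (n + 1)) m) : MvPolynomial (Param n r) ℂ :=
  ∑ i, MvPolynomial.X (Sum.inl i) * ((s : Multiset (Fin (n + 1))).map
    (Fin.cons 1 fun k => MvPolynomial.X (Sum.inr (i, k)) :
      Fin (n + 1) → MvPolynomial (Param n r) ℂ)).prod

variable {n m r}

theorem eval_affineSumPoly (z : Param n r → ℂ) (s : Sym (Fin (n + 1)) m) :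
    MvPolynomial.eval z (affineSumPoly n m r s)
      = affineSum m (fun i => z (Sum.inl i)) (fun i k => z (Sum.inr (i, k))) s := by
  have h : ∀ i : Fin r, (MvPolynomial.eval z) ∘
      (Fin.cons 1 fun k => MvPolynomial.X (Sum.inr (i, k)) :
        Fin (n + 1) → MvPolynomial (Param n r) ℂ) = Fin.cons 1 fun k => z (Sum.inr (i, k)) := by
    intro i
    funext j
    refine Fin.cases ?_ (fun k => ?_) j <;> simp
  rw [affineSumPoly, affineSum, map_sum, Finset.sum_apply]
  refine Finset.sum_congr rfl fun i _ => ?_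
  rw [map_mul, MvPolynomial.eval_X, map_multiset_prod, Multiset.map_map, h]
  rfl

/-- The matrix with columns `[v₁]_{B₀}, …, [v_r]_{B₀}`, as a matrix of polynomials. -/
noncomputable def monomialMatrix (e : Fin r → Fin n → ℕ) :
    Matrix (Fin r) (Fin r) (MvPolynomial (Param n r) ℂ) :=
  Matrix.of fun i j => ∏ k, MvPolynomial.X (Sum.inr (j, k)) ^ e i k

theorem eval_det_monomialMatrix (e : Fin r → Fin n → ℕ) (z : Param n r → ℂ) :
    MvPolynomial.eval z (monomialMatrix e).det
      = (Matrix.of fun i j : Fin r => ∏ k, z (Sum.inr (j, k)) ^ e i k).det := by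
  rw [RingHom.map_det]
  congr 1
  ext i j
  simp [monomialMatrix]

/-- In the Leibniz expansion of the determinant, different permutations give different
monomials. -/
theorem det_monomialMatrix_ne_zero {e : Fin r → Fin n → ℕ} (he : Function.Injective e) :
    (monomialMatrix e).det ≠ 0 := by
  let x : Equiv.Perm (Fin r) → (Param n r →₀ ℕ) := fun τ =>
    Finsupp.equivFunOnFinite.symm (Sum.elim 0 fun p => e (τ p.1) p.2)
  have hx : Function.Injective x := by
    intro τ ρ h
    ext1 i
    apply he
    funext k
    exact congrFun (Finsupp.equivFunOnFinite.symm.injective h) (Sum.inr (i, k))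
  have hdet : (monomialMatrix e).det
      = ∑ τ : Equiv.Perm (Fin r), MvPolynomial.C ((Equiv.Perm.sign τ : ℤ) : ℂ) *
        MvPolynomial.monomial (x τ) 1 := by
    rw [Matrix.det_apply']
    refine Finset.sum_congr rfl fun τ _ => ?_
    rw [MvPolynomial.monomial_eq, Finsupp.prod_fintype _ _ (fun _ => pow_zero _)]
    simp [x, monomialMatrix, Fintype.prod_prod_type]
  refine MvPolynomial.ne_zero_iff.mpr ⟨x 1, ?_⟩
  rw [hdet, MvPolynomial.coeff_sum, Finset.sum_eq_single 1]
  · simp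
  · intro τ _ hτ
    rw [MvPolynomial.coeff_C_mul, MvPolynomial.coeff_monomial, if_neg fun h => hτ (hx h), mul_zero]
  · simp

theorem det_mem {R P ι : Type*} [CommRing R] [CommRing P] [Algebra R P] [Fintype ι]
    [DecidableEq ι] {S : Subalgebra R P} {M : Matrix ι ι P} (hM : ∀ i j, M i j ∈ S) :
    M.det ∈ S := by
  rw [Matrix.det_apply']
  exact S.sum_mem fun τ _ => S.mul_mem (S.intCast_mem _) (S.prod_mem fun i _ => hM _ _)

theorem adjugate_mem {R P ι : Type*} [CommRing R] [CommRing P] [Algebra R P] [Fintype ι]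
    [DecidableEq ι] {S : Subalgebra R P} {M : Matrix ι ι P} (hM : ∀ i j, M i j ∈ S) (i j : ι) :
    M.adjugate i j ∈ S := by
  rw [Matrix.adjugate_apply]
  refine det_mem fun k l => ?_
  rw [Matrix.updateRow_apply]
  split_ifs
  · rw [Pi.single_apply]
    split_ifs
    exacts [S.one_mem, S.zero_mem]
  · exact hM k l

/-- By Cramer's rule, the coefficients `λ i` are rational functions of the tensor and the points
`v i`. -/
theorem isAlgebraic_param (hr : r ≤ (n + m).choose m) (a : Param n r) :
    IsAlgebraic (Algebra.adjoin (MvPolynomial.aeval (R := ℂ) (affineSumPoly n m r)).range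
      (Set.range fun p : Fin r × Fin n =>
        (MvPolynomial.X (Sum.inr p) : MvPolynomial (Param n r) ℂ)))
      (MvPolynomial.X a : MvPolynomial (Param n r) ℂ) := by
  set A := (MvPolynomial.aeval (R := ℂ) (affineSumPoly n m r)).range
  set S := Algebra.adjoin A (Set.range fun p : Fin r × Fin n =>
        (MvPolynomial.X (Sum.inr p) : MvPolynomial (Param n r) ℂ)) with hS
  have hX : ∀ p, (MvPolynomial.X (Sum.inr p) : MvPolynomial (Param n r) ℂ) ∈ S :=
    fun p => Algebra.subset_adjoin ⟨p, rfl⟩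
  rcases a with i | p
  swap
  · exact isAlgebraic_algebraMap (⟨_, hX p⟩ : S)
  obtain ⟨e⟩ := nonempty_equiv_B0 hr
  let s : Fin r → Sym (Fin (n + 1)) m := fun i => symOfExponent (e i) (sum_le_of_mem_B0 hr (e i).2)
  set M := monomialMatrix (fun i => (e i : Fin n → ℕ)) with hM
  have hM0 : M.det ≠ 0 := det_monomialMatrix_ne_zero fun i j h => e.injective (Subtype.ext h)
  have hMS : ∀ i j, M i j ∈ S := by
    intro i j
    rw [hM, monomialMatrix, Matrix.of_apply]
    exact S.prod_mem fun k _ => S.pow_mem (hX (j, k)) _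
  let lam : Fin r → MvPolynomial (Param n r) ℂ := fun i => MvPolynomial.X (Sum.inl i)
  have hMl : M.mulVec lam = fun i => affineSumPoly n m r (s i) := by
    funext i
    rw [affineSumPoly, Matrix.mulVec, dotProduct]
    refine Finset.sum_congr rfl fun j _ => ?_
    rw [prod_map_symOfExponent, mul_comm]
    rfl
  have hcr : M.det • lam = M.adjugate.mulVec fun i => affineSumPoly n m r (s i) := by
    rw [← hMl, Matrix.mulVec_mulVec, Matrix.adjugate_mul, Matrix.smul_mulVec, Matrix.one_mulVec]
  have hA : ∀ s, affineSumPoly n m r s ∈ S := fun s =>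
    S.algebraMap_mem (⟨_, MvPolynomial.X s, MvPolynomial.aeval_X _ _⟩ : A)
  have hadj : ∀ i j, M.adjugate i j ∈ S := fun i j => adjugate_mem hMS i j
  have hmem : M.det * MvPolynomial.X (Sum.inl i) ∈ S := by
    have h1 := congrFun hcr i
    rw [Pi.smul_apply, smul_eq_mul] at h1
    rw [h1, Matrix.mulVec, dotProduct]
    exact S.sum_mem fun j _ => S.mul_mem (hadj i j) (hA _)
  refine IsAlgebraic.of_smul (y := (⟨_, det_mem hMS⟩ : S)) (mem_nonZeroDivisors_of_ne_zero ?_) ?_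
  · exact fun h0 => hM0 (congrArg Subtype.val h0)
  · exact isAlgebraic_algebraMap (⟨_, hmem⟩ : S)

end Parametrization

/-! ### Homogeneous polynomials and projective sets -/

section Homogeneous

variable {ι : Type}

theorem eval_smul_of_isHomogeneous {f : MvPolynomial ι ℂ} {k : ℕ} (hf : f.IsHomogeneous k) (t : ℂ)
    (w : ι → ℂ) : MvPolynomial.eval (t • w) f = t ^ k * MvPolynomial.eval w f := by
  rw [MvPolynomial.eval_eq, MvPolynomial.eval_eq, Finset.mul_sum]
  refine Finset.sum_congr rfl fun d hd => ?_
  have h1 : ∑ i ∈ d.support, d i = k := by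
    have := hf (MvPolynomial.mem_support_iff.mp hd)
    change Finsupp.degree d = k
    rwa [Finsupp.degree_eq_weight_one]
  simp only [Pi.smul_apply, smul_eq_mul, mul_pow, Finset.prod_mul_distrib,
    Finset.prod_pow_eq_pow_sum]
  rw [h1]
  ring

/-- If a polynomial vanishes on a punctured line through the origin, then so do its homogeneous
components. -/
theorem eval_homogeneousComponent_eq_zero {f : MvPolynomial ι ℂ} {w : ι → ℂ}
    (h : ∀ t : ℂ, t ≠ 0 → MvPolynomial.eval (t • w) f = 0) (k : ℕ) :
    MvPolynomial.eval w (MvPolynomial.homogeneousComponent k f) = 0 := by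
  set p : Polynomial ℂ := ∑ j ∈ Finset.range (f.totalDegree + 1),
    Polynomial.monomial j (MvPolynomial.eval w (MvPolynomial.homogeneousComponent j f)) with hp
  have hpt : ∀ t, p.eval t = MvPolynomial.eval (t • w) f := by
    intro t
    conv_rhs => rw [← MvPolynomial.sum_homogeneousComponent f, map_sum]
    rw [hp, Polynomial.eval_finsetSum]
    refine Finset.sum_congr rfl fun j _ => ?_
    rw [Polynomial.eval_monomial,
      eval_smul_of_isHomogeneous (MvPolynomial.homogeneousComponent_isHomogeneous j f), mul_comm]
  have hp0 : p = 0 := by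
    refine Polynomial.eq_zero_of_infinite_isRoot p
      ((Set.finite_singleton (0 : ℂ)).infinite_compl.mono ?_)
    intro t ht
    exact (hpt t).trans (h t ht)
  by_cases hk : k < f.totalDegree + 1
  · have : p.coeff k = MvPolynomial.eval w (MvPolynomial.homogeneousComponent k f) := by
      rw [hp, Polynomial.finsetSum_coeff, Finset.sum_eq_single k]
      · rw [Polynomial.coeff_monomial, if_pos rfl]
      · intro j _ hj
        rw [Polynomial.coeff_monomial, if_neg hj]
      · intro hk'
        exact absurd (Finset.mem_range.mpr hk) hk'
    rw [← this, hp0, Polynomial.coeff_zero]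
  · rw [MvPolynomial.homogeneousComponent_eq_zero _ _ (by omega), map_zero]

theorem eval_rep_mk_eq_zero_iff {f : MvPolynomial ι ℂ} {k : ℕ} (hf : f.IsHomogeneous k)
    {w : ι → ℂ} (hw : w ≠ 0) :
    MvPolynomial.eval (Projectivization.mk ℂ w hw).rep f = 0 ↔ MvPolynomial.eval w f = 0 := by
  obtain ⟨a, ha⟩ := Projectivization.exists_smul_eq_mk_rep ℂ w hw
  rw [← ha, Units.smul_def, eval_smul_of_isHomogeneous hf, mul_eq_zero,
    or_iff_right (pow_ne_zero _ a.ne_zero)]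

theorem subset_projClosure (Z : Set (ℙ ℂ (ι → ℂ))) : Z ⊆ projClosure Z :=
  Set.subset_sInter fun _ hW => hW.2

end Homogeneous

/-! ### The cone over the secant variety -/

section Cone

variable {n m r : ℕ}

theorem tensorPow_smul (c : ℂ) (u : Fin (n + 1) → ℂ) :
    tensorPow m (c • u) = c ^ m • tensorPow m u := by
  funext s
  change ((s : Multiset (Fin (n + 1))).map fun i => c * u i).prod = _
  rw [Multiset.prod_map_mul, Multiset.map_const', Multiset.prod_replicate]
  have : Multiset.card (s : Multiset (Fin (n + 1))) = m := s.2
  rw [this]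
  rfl

/-- The coefficients are absorbed into the vectors as `m`-th powers. -/
theorem mk_affineSum_mem (hm : 0 < m) (lam : Fin r → ℂ) (v : Fin r → Fin n → ℂ)
    (h : affineSum m lam v ≠ 0) : Projectivization.mk ℂ _ h ∈ secantVariety n m r := by
  choose μ hμ using fun i => IsAlgClosed.exists_pow_nat_eq (lam i) hm
  have heq : affineSum m lam v
      = ∑ i, tensorPow m (μ i • (Fin.cons 1 (v i) : Fin (n + 1) → ℂ)) :=
    Finset.sum_congr rfl fun i _ => by rw [tensorPow_smul, hμ]
  refine subset_projClosure _ ⟨fun i => μ i • (Fin.cons 1 (v i) : Fin (n + 1) → ℂ), heq ▸ h, ?_⟩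
  congr 1

theorem affineSum_smul (c : ℂ) (lam : Fin r → ℂ) (v : Fin r → Fin n → ℂ) :
    affineSum m (c • lam) v = c • affineSum m lam v := by
  rw [affineSum, affineSum, Finset.smul_sum]
  exact Finset.sum_congr rfl fun i _ => by rw [Pi.smul_apply, smul_assoc]

/-- If all parameters are one, all entries of the tensor are `r`. -/
theorem affineSumPoly_ne_zero (hr : 0 < r) (s : Sym (Fin (n + 1)) m) :
    affineSumPoly n m r s ≠ 0 := by
  intro h
  have h1 := eval_affineSumPoly (r := r) (fun _ => 1) s
  have h2 : tensorPow m (Fin.cons 1 fun _ => 1 : Fin (n + 1) → ℂ) s = 1 := by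
    have : (Fin.cons 1 fun _ => 1 : Fin (n + 1) → ℂ) = fun _ => 1 := by
      funext k
      refine Fin.cases ?_ (fun k => ?_) k <;> simp
    rw [this]
    simp [tensorPow]
  rw [h, map_zero, affineSum, Finset.sum_apply] at h1
  simp only [Pi.smul_apply, h2, smul_eq_mul, mul_one, Finset.sum_const, Finset.card_univ,
    Fintype.card_fin, nsmul_eq_mul] at h1
  exact hr.ne (Nat.cast_eq_zero.mp h1.symm).symm

theorem mem_ker_aeval_iff {f : MvPolynomial (Sym (Fin (n + 1)) m) ℂ} :
    MvPolynomial.aeval (affineSumPoly n m r) f = 0 ↔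
      ∀ (lam : Fin r → ℂ) (v : Fin r → Fin n → ℂ),
        MvPolynomial.eval (affineSum m lam v) f = 0 := by
  have key : ∀ z, MvPolynomial.eval z (MvPolynomial.aeval (affineSumPoly n m r) f) =
      MvPolynomial.eval
        (affineSum m (fun i => z (Sum.inl i)) (fun i k => z (Sum.inr (i, k)))) f := by
    intro z
    rw [MvPolynomial.aeval_def, MvPolynomial.eval_eval₂, MvPolynomial.eval]
    congr 1
    · ext a; simp
    · funext s
      exact eval_affineSumPoly z s
  refine ⟨fun h lam v => ?_, fun h => MvPolynomial.funext fun z => ?_⟩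
  · have := key (Sum.elim lam fun p => v p.1 p.2)
    rw [h, map_zero] at this
    exact this.symm
  · rw [key, h, map_zero]

theorem aeval_homogeneousComponent_eq_zero {f : MvPolynomial (Sym (Fin (n + 1)) m) ℂ}
    (hf : MvPolynomial.aeval (affineSumPoly n m r) f = 0) (k : ℕ) :
    MvPolynomial.aeval (affineSumPoly n m r) (MvPolynomial.homogeneousComponent k f) = 0 := by
  rw [mem_ker_aeval_iff] at hf ⊢
  intro lam v
  refine eval_homogeneousComponent_eq_zero (fun t _ => ?_) k
  rw [← affineSum_smul]
  exact hf _ _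

/-- A polynomial that vanishes at all `∑ λ i (1, v i)^{⊗ m}` vanishes at all `∑ (u i)^{⊗ m}`, since
the vectors `u` with a nonzero first coordinate are dense. -/
theorem eval_sum_tensorPow_eq_zero {f : MvPolynomial (Sym (Fin (n + 1)) m) ℂ}
    (hf : MvPolynomial.aeval (affineSumPoly n m r) f = 0) (u : Fin r → Fin (n + 1) → ℂ) :
    MvPolynomial.eval (∑ i, tensorPow m (u i)) f = 0 := by
  rw [mem_ker_aeval_iff] at hf
  let ψ : Sym (Fin (n + 1)) m → MvPolynomial (Fin r × Fin (n + 1)) ℂ := fun s =>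
    ∑ i, ((s : Multiset (Fin (n + 1))).map fun k => MvPolynomial.X (i, k)).prod
  have key : ∀ z, MvPolynomial.eval z (MvPolynomial.aeval ψ f) =
      MvPolynomial.eval (∑ i, tensorPow m fun k => z (i, k)) f := by
    intro z
    rw [MvPolynomial.aeval_def, MvPolynomial.eval_eval₂, MvPolynomial.eval]
    congr 1
    · ext a; simp
    · funext s
      rw [map_sum, Finset.sum_apply]
      refine Finset.sum_congr rfl fun i _ => ?_
      rw [map_multiset_prod, Multiset.map_map]
      simp [tensorPow, Function.comp_def]
  have hprod : MvPolynomial.aeval ψ f * ∏ i, MvPolynomial.X (i, 0) = 0 := by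
    refine MvPolynomial.funext fun z => ?_
    rw [map_mul, map_zero, key]
    by_cases hz : ∃ i, z (i, 0) = 0
    · obtain ⟨i, hi⟩ := hz
      rw [map_prod, Finset.prod_eq_zero (Finset.mem_univ i) (by simpa using hi), mul_zero]
    · push Not at hz
      have h1 : ∑ i, tensorPow m (fun k => z (i, k))
          = affineSum m (fun i => z (i, 0) ^ m) (fun i k => z (i, k.succ) / z (i, 0)) := by
        refine Finset.sum_congr rfl fun i _ => ?_
        rw [← tensorPow_smul]
        congr 1
        funext k
        refine Fin.cases ?_ (fun k => ?_) k
        · simp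
        · simp [mul_div_cancel₀ _ (hz i)]
      rw [h1, hf, zero_mul]
  have hne : (∏ i, MvPolynomial.X (i, 0) : MvPolynomial (Fin r × Fin (n + 1)) ℂ) ≠ 0 :=
    Finset.prod_ne_zero_iff.mpr fun i _ => MvPolynomial.X_ne_zero _
  have h0 := (mul_eq_zero.mp hprod).resolve_right hne
  have h1 := key fun p => u p.1 p.2
  rw [h0, map_zero] at h1
  exact h1.symm

theorem mem_affineCone_rep {ι : Type} {Z : Set (ℙ ℂ (ι → ℂ))} {x : ℙ ℂ (ι → ℂ)} (hx : x ∈ Z) :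
    x.rep ∈ affineCone Z := fun h => by
  rwa [Projectivization.mk_rep]

/-- The ideal of the affine cone over the secant variety is the kernel of the parametrization. -/
theorem vanishingIdeal_affineCone (hm : 0 < m) :
    MvPolynomial.vanishingIdeal ℂ (affineCone (secantVariety n m r)) =
      RingHom.ker (MvPolynomial.aeval (R := ℂ) (affineSumPoly n m r)) := by
  ext f
  rw [MvPolynomial.mem_vanishingIdeal_iff, RingHom.mem_ker]
  constructor
  · intro h
    rw [mem_ker_aeval_iff]
    intro lam v
    exact (congrFun (congrArg _ (MvPolynomial.coe_aeval_eq_eval _).symm) f).trans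
      (h _ fun hne => mk_affineSum_mem hm lam v hne)
  · intro h w hw
    rw [MvPolynomial.aeval_eq_eval]
    by_cases hw0 : w = 0
    · have h0 := mem_ker_aeval_iff.mp h 0 0
      have : affineSum m 0 (0 : Fin r → Fin n → ℂ) = 0 := by simp [affineSum]
      rw [hw0, ← this]
      exact h0
    · change MvPolynomial.eval w f = 0
      rw [← MvPolynomial.sum_homogeneousComponent f, map_sum]
      refine Finset.sum_eq_zero fun k _ => ?_
      have hk := aeval_homogeneousComponent_eq_zero h k
      have hhom := MvPolynomial.homogeneousComponent_isHomogeneous k f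
      have hsub : secantVariety n m r ⊆
          {x | MvPolynomial.eval x.rep (MvPolynomial.homogeneousComponent k f) = 0} := by
        refine Set.sInter_subset_of_mem ⟨⟨{MvPolynomial.homogeneousComponent k f},
          by rintro _ rfl; exact ⟨k, hhom⟩, by simp⟩, ?_⟩
        rintro _ ⟨u, hu, rfl⟩
        exact (eval_rep_mk_eq_zero_iff hhom hu).mpr (eval_sum_tensorPow_eq_zero hk u)
      exact (eval_rep_mk_eq_zero_iff hhom hw0).mp (hsub (hw hw0))

/-- A property of general tensors in the sense of `genericFilter`, for some representative, is a
property of general points of the secant variety: the polynomial `h` has a homogeneous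
component that does not vanish identically, and where this component is nonzero, so is `h` at a
multiple of the tensor. -/
theorem forGeneralPoint_of_eventually (hm : 0 < m) (hr : 0 < r) {Q : SymTensor n m → Prop}
    (hQ : ∀ᶠ F in genericFilter (affineSumPoly n m r), Q F) {P : ℙ ℂ (SymTensor n m) → Prop}
    (hP : ∀ (F : SymTensor n m) (hF : F ≠ 0), Q F → P (Projectivization.mk ℂ F hF)) :
    ForGeneralPoint (secantVariety n m r) P := by
  obtain ⟨h, h0, hQ⟩ := eventually_genericFilter.mp hQ
  obtain ⟨k, hk⟩ : ∃ k, MvPolynomial.aeval (affineSumPoly n m r)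
      (MvPolynomial.homogeneousComponent k h) ≠ 0 := by
    by_contra! hall
    apply h0
    rw [← MvPolynomial.sum_homogeneousComponent h, map_sum]
    exact Finset.sum_eq_zero fun k _ => hall k
  set H := MvPolynomial.homogeneousComponent k h
  have hhom : H.IsHomogeneous k := MvPolynomial.homogeneousComponent_isHomogeneous k h
  refine ⟨{x | MvPolynomial.eval x.rep H ≠ 0}, ⟨{H}, by rintro _ rfl; exact ⟨k, hhom⟩, ?_⟩, ?_, ?_⟩
  · ext x
    simp
  · refine Set.subset_sInter ?_
    rintro W ⟨⟨I, hI, rfl⟩, hW⟩ x hx f hf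
    obtain ⟨j, hj⟩ := hI f hf
    -- The factor `X s` takes care of the parameters that give the zero tensor.
    obtain ⟨s⟩ : Nonempty (Sym (Fin (n + 1)) m) := inferInstance
    have hfH : MvPolynomial.aeval (affineSumPoly n m r) (f * H * MvPolynomial.X s) = 0 := by
      rw [mem_ker_aeval_iff]
      intro lam v
      rw [map_mul, map_mul, MvPolynomial.eval_X]
      by_cases hF : affineSum m lam v = 0
      · rw [hF, Pi.zero_apply, mul_zero]
      · by_cases hH : MvPolynomial.eval (affineSum m lam v) H = 0
        · rw [hH, mul_zero, zero_mul]
        · have := hW ⟨mk_affineSum_mem hm lam v hF,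
            fun h' => hH ((eval_rep_mk_eq_zero_iff hhom hF).mp h')⟩ f hf
          rw [(eval_rep_mk_eq_zero_iff hj hF).mp this, zero_mul, zero_mul]
    rw [map_mul, map_mul, MvPolynomial.aeval_X, mul_eq_zero, mul_eq_zero, or_iff_left hk,
      or_iff_left (affineSumPoly_ne_zero hr s), ← RingHom.mem_ker,
      ← vanishingIdeal_affineCone hm] at hfH
    exact (congrFun (congrArg _ (MvPolynomial.coe_aeval_eq_eval _).symm) f).trans
      (hfH _ (mem_affineCone_rep hx))
  · rintro x ⟨hx, hxH⟩
    obtain ⟨t, ht, hth⟩ : ∃ t : ℂ, t ≠ 0 ∧ MvPolynomial.eval (t • x.rep) h ≠ 0 := by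
      by_contra! hall
      exact hxH (eval_homogeneousComponent_eq_zero hall k)
    have hne : t • x.rep ≠ 0 := smul_ne_zero ht x.rep_nonzero
    have hmk : Projectivization.mk ℂ (t • x.rep) hne = x := by
      conv_rhs => rw [← Projectivization.mk_rep x]
      exact (Projectivization.mk_eq_mk_iff' ℂ _ _ _ _).mpr ⟨t, rfl⟩
    rw [← hmk]
    refine hP _ hne (hQ _ ?_ hth)
    rw [← vanishingIdeal_affineCone hm]
    refine MvPolynomial.zeroLocus_vanishingIdeal_le _ fun h' => ?_
    rwa [hmk]

end Cone

/-! ### Affine fibres -/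

section Fibre

variable {n m r : ℕ}

theorem affineSum_comp (τ : Equiv.Perm (Fin r)) (lam : Fin r → ℂ) (v : Fin r → Fin n → ℂ) :
    affineSum m (lam ∘ τ) (v ∘ τ) = affineSum m lam v :=
  Equiv.sum_comp τ fun i => lam i • tensorPow m (Fin.cons 1 (v i) : Fin (n + 1) → ℂ)

theorem sUnion_afiber {F : SymTensor n m} (hF : F ≠ 0) :
    ⋃₀ afiber r (Projectivization.mk ℂ F hF) = {v | ∃ lam, affineSum m lam v = F} := by
  ext w
  constructor
  · rintro ⟨_, ⟨v, rfl, lam, h, hFv⟩, τ, rfl⟩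
    obtain ⟨a, ha⟩ := (Projectivization.mk_eq_mk_iff' ℂ _ _ _ _).mp hFv
    exact ⟨(a • lam) ∘ τ, by rw [affineSum_comp, affineSum_smul, ha]⟩
  · rintro ⟨lam, h⟩
    exact ⟨perm w, ⟨w, rfl, lam, h ▸ hF, by simp only [h]⟩, 1, rfl⟩

theorem exists_affineSum_eq_of_perm_mem {F : SymTensor n m} (hF : F ≠ 0)
    {v : Fin r → Fin n → ℂ} (h : perm v ∈ afiber r (Projectivization.mk ℂ F hF)) :
    ∃ lam, affineSum m lam v = F := by
  have : v ∈ ⋃₀ afiber r (Projectivization.mk ℂ F hF) := ⟨perm v, h, 1, rfl⟩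
  rwa [sUnion_afiber] at this

end Fibre

/-! ### The dimension of a general fibre -/

section FibreDimension

/-- The dimension of the projection of a general fibre to the coordinates `v`: any `d + 1`
coordinates are related on it, and `d` of them are not. -/
theorem eventually_affineDim_fibre {σ ι E κ : Type} [Finite σ] [Finite E] [Finite κ]
    {φ : ι → MvPolynomial σ ℂ} {ε : E → ι} (hε : AlgebraicIndependent ℂ (φ ∘ ε)) (v : κ → σ)
    {d : ℕ} {x : Fin d → κ} (hx : IsTranscendenceBasis (MvPolynomial.aeval (R := ℂ) φ).range
      (fun j => (MvPolynomial.X (v (x j)) : MvPolynomial σ ℂ)))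
    (hcard : Nat.card E + d = Nat.card σ) :
    ∀ᶠ F in genericFilter φ, affineDim
      ((fun z : σ → ℂ => z ∘ v) '' {z | ∀ i, MvPolynomial.eval z (φ i) = F i}) = d := by
  have h1 : ∀ᶠ F in genericFilter φ, ∀ y : Fin (d + 1) → κ,
      ∃ q : MvPolynomial (Fin (d + 1)) ℂ, q ≠ 0 ∧ ∀ z : σ → ℂ,
      (∀ i, MvPolynomial.eval z (φ i) = F i) → MvPolynomial.eval
        (fun j => MvPolynomial.eval z (MvPolynomial.X (v (y j)))) q = 0 :=
    Filter.eventually_all.mpr fun y => eventually_exists_relation_of_lt hε _ (by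
      rw [Nat.card_eq_fintype_card (α := Fin (d + 1)), Fintype.card_fin]
      omega)
  filter_upwards [h1, eventually_dense hx] with F hF hFd
  set T := (fun z : σ → ℂ => z ∘ v) '' {z | ∀ i, MvPolynomial.eval z (φ i) = F i}
  set J := MvPolynomial.vanishingIdeal ℂ T
  have key : ∀ {a : ℕ} (y : Fin a → κ) (q : MvPolynomial (Fin a) ℂ),
      MvPolynomial.aeval ((fun k => Ideal.Quotient.mkₐ ℂ J (MvPolynomial.X k)) ∘ y) q = 0 ↔
        ∀ z : σ → ℂ, (∀ i, MvPolynomial.eval z (φ i) = F i) →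
          MvPolynomial.eval (z ∘ v ∘ y) q = 0 := by
    intro a y q
    have h2 : MvPolynomial.aeval ((fun k => Ideal.Quotient.mkₐ ℂ J (MvPolynomial.X k)) ∘ y) q
        = Ideal.Quotient.mkₐ ℂ J (MvPolynomial.rename y q) := by
      rw [MvPolynomial.rename_eq_aeval, MvPolynomial.comp_aeval_apply]
      rfl
    rw [h2, Ideal.Quotient.mkₐ_eq_mk, Ideal.Quotient.eq_zero_iff_mem,
      MvPolynomial.mem_vanishingIdeal_iff]
    simp only [T, Set.forall_mem_image, Set.mem_ofPred_eq, MvPolynomial.aeval_rename,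
      MvPolynomial.aeval_eq_eval]
    rfl
  have hadj : Algebra.adjoin ℂ (Set.range fun k => Ideal.Quotient.mkₐ ℂ J (MvPolynomial.X k))
      = ⊤ := by
    have : (fun k => Ideal.Quotient.mkₐ ℂ J (MvPolynomial.X k))
        = Ideal.Quotient.mkₐ ℂ J ∘ MvPolynomial.X := rfl
    rw [this, Set.range_comp, ← AlgHom.map_adjoin, MvPolynomial.adjoin_range_X, Algebra.map_top,
      (AlgHom.range_eq_top _).mpr (Ideal.Quotient.mkₐ_surjective ℂ J)]
  refine le_antisymm (ringKrullDim_le_of_forall_not_algebraicIndependent hadj fun y hy => ?_)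
    (le_ringKrullDim_of_algebraicIndependent (k := ℂ)
      (x := (fun k => Ideal.Quotient.mkₐ ℂ J (MvPolynomial.X k)) ∘ x) ?_)
  · obtain ⟨q, hq0, hq⟩ := hF y
    refine hq0 (algebraicIndependent_iff.mp hy q ((key y q).mpr fun z hz => ?_))
    simpa [Function.comp_def] using hq z hz
  · exact algebraicIndependent_iff.mpr fun u hu => hFd u ((key x u).mp hu)

end FibreDimension

/-! ### General linear and affine sections of a general fibre -/

section Sections

variable {n m r : ℕ}

/-- The polynomial is the minor of the columns `x`. -/
theorem exists_linearIndependent_of_eval_ne_zero {d : ℕ} {x : Fin d → Fin r × Fin n}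
    (hx : Function.Injective x) :
    ∃ p : MvPolynomial (Fin d × Fin r × Fin n) ℂ, p ≠ 0 ∧ ∀ A : Fin d → Fin r → Fin n → ℂ,
      MvPolynomial.eval (fun y => A y.1 y.2.1 y.2.2) p ≠ 0 → LinearIndependent ℂ A := by
  refine ⟨MvPolynomial.rename (Prod.map id x) (Matrix.mvPolynomialX (Fin d) (Fin d) ℂ).det, ?_,
    fun A hA => ?_⟩
  · rw [Ne, MvPolynomial.rename_eq_zero_iff_of_injective _ (Function.injective_id.prodMap hx)]
    exact Matrix.det_mvPolynomialX_ne_zero _ _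
  · rw [MvPolynomial.eval_rename, Matrix.eval_det_mvPolynomialX] at hA
    let L : (Fin r → Fin n → ℂ) →ₗ[ℂ] (Fin d → ℂ) :=
      LinearMap.pi fun j => (LinearMap.proj (R := ℂ) (φ := fun _ : Fin n => ℂ) (x j).2).comp
        (LinearMap.proj (R := ℂ) (φ := fun _ : Fin r => Fin n → ℂ) (x j).1)
    exact LinearIndependent.of_comp L (Matrix.linearIndependent_rows_of_det_ne_zero hA)

theorem eval_affineSumPoly_elim {lam : Fin r → ℂ} {v : Fin r → Fin n → ℂ} {F : SymTensor n m}
    (h : affineSum m lam v = F) (s : Sym (Fin (n + 1)) m) :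
    MvPolynomial.eval (Sum.elim lam fun p => v p.1 p.2) (affineSumPoly n m r s) = F s := by
  rw [eval_affineSumPoly, ← h]
  rfl

theorem eval_det_eq_zero_of_notMem_D (e : Fin r ≃ B0 n r) (lam : Fin r → ℂ)
    {v : Fin r → Fin n → ℂ} (hv : v ∉ D n r) :
    MvPolynomial.eval (Sum.elim lam fun p => v p.1 p.2)
      (monomialMatrix fun i => (e i : Fin n → ℕ)).det = 0 := by
  rw [eval_det_monomialMatrix]
  by_contra h
  exact hv ⟨e, h⟩

variable {E : Type} [Finite E] {ε : E → Sym (Fin (n + 1)) m} {d : ℕ} {x : Fin d → Fin r × Fin n}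

/-- A general affine subspace of codimension `d` misses the part of a general fibre outside `D`. -/
theorem eventually_forGeneralAffineSubspace (hr : r ≤ (n + m).choose m)
    (hε : AlgebraicIndependent ℂ (affineSumPoly n m r ∘ ε)) (hx : Function.Injective x)
    (hcard : Nat.card (Param n r) ≤ Nat.card E + d) :
    ∀ᶠ F in genericFilter (affineSumPoly n m r), ForGeneralAffineSubspace n r d fun S =>
      ∀ v : Fin r → Fin n → ℂ, (∃ lam, affineSum m lam v = F) → v ∈ S → v ∈ D n r := by
  obtain ⟨e⟩ := nonempty_equiv_B0 hr
  obtain ⟨q, hq0, hq⟩ := exists_linearIndependent_of_eval_ne_zero hx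
  -- The equations `A v = b` are linear in the homogeneous coordinates `(-1, v)`.
  filter_upwards [eventually_linear_section hε
    (fun k : Option (Fin r × Fin n) => k.elim (MvPolynomial.C (-1))
      fun p => MvPolynomial.X (Sum.inr p)) none
    (det_monomialMatrix_ne_zero (e := fun i => (e i : Fin n → ℕ))
      (Subtype.val_injective.comp e.injective)) d hcard] with F ⟨p, hp0, hp⟩
  let f : Fin d × Option (Fin r × Fin n) → (Fin d × Fin r × Fin n) ⊕ Fin d :=
    fun y => y.2.elim (Sum.inr y.1) fun p => Sum.inl (y.1, p)
  have hf : Function.Injective f := by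
    rintro ⟨i, _ | p⟩ ⟨j, _ | q⟩ h <;> simp_all [f]
  refine ⟨MvPolynomial.rename Sum.inl q * MvPolynomial.rename f p, mul_ne_zero ?_ ?_,
    fun A b hAb => ?_⟩
  · rwa [Ne, MvPolynomial.rename_eq_zero_iff_of_injective _ Sum.inl_injective]
  · rwa [Ne, MvPolynomial.rename_eq_zero_iff_of_injective _ hf]
  · rw [map_mul, MvPolynomial.eval_rename, MvPolynomial.eval_rename] at hAb
    refine ⟨hq A (left_ne_zero_of_mul hAb), ?_⟩
    rintro v ⟨lam, hv⟩ hvS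
    by_contra hvD
    refine right_ne_zero_of_mul hAb (hp _ (eval_affineSumPoly_elim hv)
      (eval_det_eq_zero_of_notMem_D e lam hvD) (by simp) _ fun i => ?_)
    have h1 : ∑ j, ∑ k, A i j k * v j k = b i := hvS i
    simp [Fintype.sum_option, Fintype.sum_prod_type, f, h1]

/-- A general linear subspace of codimension `d` misses the part of a general fibre outside `D`. The
point `v = 0`, which lies on all linear subspaces, is not in a general fibre, because a general
tensor is not a multiple of `(1, 0)^{⊗ m}`. -/
theorem eventually_forGeneralLinearSubspace (hm : 0 < m) (hr₀ : 0 < r)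
    (hr : r ≤ (n + m).choose m)
    (hε : AlgebraicIndependent ℂ (affineSumPoly n m r ∘ ε)) (hx : Function.Injective x)
    (hcard : Nat.card (Param n r) ≤ Nat.card E + d) (hd : 0 < d) :
    ∀ᶠ F in genericFilter (affineSumPoly n m r), ForGeneralLinearSubspace n r d fun S =>
      ∀ v : Fin r → Fin n → ℂ, (∃ lam, affineSum m lam v = F) → v ∈ S → v ∈ D n r := by
  obtain ⟨e⟩ := nonempty_equiv_B0 hr
  obtain ⟨q, hq0, hq⟩ := exists_linearIndependent_of_eval_ne_zero hx
  let k₁ : Fin n := (x ⟨0, hd⟩).2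
  have hne : ∀ᶠ F in genericFilter (affineSumPoly n m r), F (Sym.replicate m k₁.succ) ≠ 0 :=
    eventually_genericFilter.mpr ⟨MvPolynomial.X (Sym.replicate m k₁.succ), by
      rw [MvPolynomial.aeval_X]; exact affineSumPoly_ne_zero hr₀ _, fun F _ h => by
      rwa [MvPolynomial.eval_X] at h⟩
  have hsec := Filter.eventually_all.mpr fun p : Fin r × Fin n => eventually_linear_section hε
    (fun p : Fin r × Fin n => MvPolynomial.X (Sum.inr p)) p
    (det_monomialMatrix_ne_zero (e := fun i => (e i : Fin n → ℕ))
      (Subtype.val_injective.comp e.injective)) d hcard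
  filter_upwards [hne, hsec] with F hF hsec
  choose p hp0 hp using hsec
  refine ⟨q * ∏ y, p y, mul_ne_zero hq0 (Finset.prod_ne_zero_iff.mpr fun y _ => hp0 y),
    fun A hA => ?_⟩
  rw [map_mul, map_prod] at hA
  refine ⟨hq A (left_ne_zero_of_mul hA), ?_⟩
  rintro v ⟨lam, hv⟩ hvS
  by_contra hvD
  obtain ⟨i, k, hik⟩ : ∃ i k, v i k ≠ 0 := by
    by_contra! h0
    apply hF
    rw [← hv, affineSum, Finset.sum_apply]
    refine Finset.sum_eq_zero fun i _ => ?_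
    simp [tensorPow, Sym.coe_replicate, h0, hm.ne']
  refine Finset.prod_ne_zero_iff.mp (right_ne_zero_of_mul hA) (i, k) (Finset.mem_univ _)
    (hp (i, k) _ (eval_affineSumPoly_elim hv) (eval_det_eq_zero_of_notMem_D e lam hvD)
      (by simpa using hik) _ fun i => ?_)
  have h1 : ∑ j, ∑ k, A i j k * v j k = 0 := hvS i
  simpa [Fintype.sum_prod_type] using h1

end Sections

end SymDecomp

theorem mainTheorem3 (n m r : ℕ) (hm : 0 < m) (hr : 0 < r) (hrN : r ≤ (n + m).choose m) :
    ∃ s d : ℕ,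
      SymDecomp.HasProjDim (SymDecomp.secantVariety n m r) s ∧
      (d : ℤ) = r * (n + 1) - 1 - s ∧
      SymDecomp.ForGeneralPoint (SymDecomp.secantVariety n m r) fun F =>
        SymDecomp.dimClasses (SymDecomp.afiber r F) = d ∧
        (d = 0 → ∀ v : Fin r → Fin n → ℂ,
          SymDecomp.perm v ∈ SymDecomp.afiber r F → v ∈ SymDecomp.D n r) ∧
        (0 < d →
          SymDecomp.ForGeneralLinearSubspace n r d (fun S => ∀ v : Fin r → Fin n → ℂ,
            SymDecomp.perm v ∈ SymDecomp.afiber r F → v ∈ S → v ∈ SymDecomp.D n r) ∧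
          SymDecomp.ForGeneralAffineSubspace n r d (fun S => ∀ v : Fin r → Fin n → ℂ,
            SymDecomp.perm v ∈ SymDecomp.afiber r F → v ∈ S → v ∈ SymDecomp.D n r)) := by
  open SymDecomp in
  obtain ⟨e, d, ε, x, hε, hx, hed, hdim⟩ := exists_transcendence_data (affineSumPoly n m r)
    (Sum.inr : Fin r × Fin n → Param n r) (isAlgebraic_param hrN)
  have hparam : Nat.card (Param n r) = r + r * n := by simp [Param]
  have hxinj : Function.Injective x := fun i j hij => by
    have hij' : (fun j => (MvPolynomial.X (Sum.inr (x j)) : MvPolynomial (Param n r) ℂ)) i =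
        (fun j => MvPolynomial.X (Sum.inr (x j))) j := by simp only [hij]
    exact hx.1.injective hij'
  have hdle : d ≤ r * n := by simpa using Fintype.card_le_of_injective x hxinj
  rw [hparam] at hed
  have hcard : Nat.card (Param n r) ≤ Nat.card (Fin e) + d := by
    rw [hparam, Nat.card_eq_fintype_card, Fintype.card_fin, hed]
  have hperm : ∀ {F : SymTensor n m} (hF : F ≠ 0) {v : Fin r → Fin n → ℂ},
      perm v ∈ afiber r (Projectivization.mk ℂ F hF) → ∃ lam, affineSum m lam v = F :=
    fun hF _ => exists_affineSum_eq_of_perm_mem hF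
  have hdimF := eventually_affineDim_fibre hε _ hx (by
    rw [hparam, Nat.card_eq_fintype_card, Fintype.card_fin, hed])
  have haff := eventually_forGeneralAffineSubspace hrN hε hxinj hcard
  have hlin : ∀ᶠ F in genericFilter (affineSumPoly n m r), 0 < d →
      ForGeneralLinearSubspace n r d fun S =>
        ∀ v : Fin r → Fin n → ℂ, (∃ lam, affineSum m lam v = F) → v ∈ S → v ∈ D n r := by
    rcases Nat.eq_zero_or_pos d with h0 | h0
    · exact Filter.Eventually.of_forall fun F h => absurd h0 h.ne'
    · exact (eventually_forGeneralLinearSubspace hm hr hrN hε hxinj hcard h0).mono fun F h _ => h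
  refine ⟨e - 1, d, ?_, ?_, forGeneralPoint_of_eventually hm hr (hdimF.and (haff.and hlin)) ?_⟩
  · rw [HasProjDim, affineDim, vanishingIdeal_affineCone hm, hdim]
    -- Here `e ≥ r > 0`, because `e + d = r + r n` and `d ≤ r n`.
    have : e = (e - 1) + 1 := by omega
    conv_lhs => rw [this]
    push_cast
    rfl
  · have : (e : ℤ) + d = r + r * n := by exact_mod_cast hed
    have h1 : ((e - 1 : ℕ) : ℤ) = e - 1 := by
      rw [Nat.cast_sub (by omega), Nat.cast_one]
    rw [h1]
    linarith
  · rintro F hF ⟨hFdim, ⟨p, hp0, hp⟩, hFlin⟩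
    refine ⟨?_, ?_, fun hd => ⟨?_, ?_⟩⟩
    · rw [dimClasses, sUnion_afiber, ← hFdim]
      congr 1
      ext w
      constructor
      · rintro ⟨v, ⟨lam, hv⟩, rfl⟩
        exact ⟨Sum.elim lam fun p => v p.1 p.2, eval_affineSumPoly_elim hv, rfl⟩
      · rintro ⟨z, hz, rfl⟩
        refine ⟨fun i k => z (Sum.inr (i, k)), ⟨fun i => z (Sum.inl i), ?_⟩, rfl⟩
        funext s
        rw [← hz s, eval_affineSumPoly]
    · -- A subspace of codimension zero is the whole space.
      rintro rfl v hv
      obtain ⟨a, ha⟩ : ∃ a, MvPolynomial.eval a p ≠ 0 := by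
        by_contra! h0
        exact hp0 (MvPolynomial.funext fun a => by rw [h0, map_zero])
      refine (hp (fun i => i.elim0) (fun i => i.elim0) ?_).2 v (hperm hF hv) fun i => i.elim0
      convert ha using 3
      exact Subsingleton.elim _ _
    · obtain ⟨q, hq0, hq⟩ := hFlin hd
      exact ⟨q, hq0, fun A hA => ⟨(hq A hA).1, fun v hv => (hq A hA).2 v (hperm hF hv)⟩⟩
    · exact ⟨p, hp0, fun A b hA => ⟨(hp A b hA).1, fun v hv => (hp A b hA).2 v (hperm hF hv)⟩⟩
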